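/- \textbf{Theorem (Hartogs).} Let $\mathbb A$ be a finite-dimensional real alternative algebra with unit $1$ (not necessarily associative; $\mathbb R$ is identified with $\mathbb R1$), equipped with an anti-involution, i.e. a real linear map $a\mapsto a^{c}$ with $(a^c)^c=a$, $(ab)^c=b^ca^c$ and $r^c=r$ for $r\in\mathbb R$. Write $t(x)=x+x^c$, $n(x)=xx^c$, $\mathbb S_{\mathbb A}=\{x\in\mathbb A: t(x)=0,\ n(x)=1\}$ and $Q_{\mathbb A}=\mathbb R\cup\{x\in\mathbb A: t(x)\in\mathbb R,\ n(x)\in\mathbb R,\ 4n(x)>t(x)^2\}$. Let $M$ be a hypercomplex subspace of $\mathbb A$, i.e. a real vector subspace with $\mathbb R\subsetneq M\subseteq Q_{\mathbb A}$, and let $(v_0,v_1,\dots,v_m)$, $m\ge 1$, be a hypercomplex basis of $M$, i.e. a real vector basis of $M$ with $v_0=1$, $v_s\in\mathbb S_{\mathbb A}$ and $v_sv_t=-v_tv_s$ for all distinct $s,t\in\{1,\dots,m\}$. Complete it to a real vector basis of $\mathbb A$. For $n\ge 1$ identify $x=(x_{j,s})\in\mathbb R^{(m+1)n}$ ($1\le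 j\le n$, $0\le s\le m$) with $(x_1,\dots,x_n)\in M^n$, $x_j=\sum_{s=0}^m x_{j,s}v_s$. A function $f:U\to\mathbb A$ on an open set $U\subseteq M^n$ is called left (respectively right) monogenic if all its real components with respect to the basis of $\mathbb A$ are of class $C^1$ on $U$ and $$\sum_{s=0}^m v_s\,\frac{\partial f}{\partial x_{j,s}}(x)=0\qquad\Big(\text{respectively } \sum_{s=0}^m \frac{\partial f}{\partial x_{j,s}}(x)\,v_s=0\Big),\qquad x\in U,\ j=1,\dots,n.$$ Let $n>1$, let $\Omega\subseteq M^n$ be a domain (a non-empty connected open set), and let $K\subset\Omega$ be a compact set such that $\Omega\setminus K$ is connected. Then for every left monogenic function $f$ on $\Omega\setminus K$ there is a left monogenic function $F$ on $\Omega$ with $F=f$ on $\Omega\setminus K$; and the same holds with "right monogenic" in place of "left monogenic". -/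

import Mathlib

/-- The two alternative laws, for a not necessarily associative multiplication. -/
structure IsAlternative (A : Type*) [NonAssocRing A] : Prop where
  left_alt : ∀ a b : A, (a * a) * b = a * (a * b)
  right_alt : ∀ a b : A, (b * a) * a = b * (a * a)

/-- The sphere of imaginary units: trace `x + xᶜ = 0` and squared norm `x xᶜ = 1`,
the anti-involution `xᶜ` being written `star x`. -/
def imaginaryUnits (A : Type*) [NonAssocRing A] [StarRing A] : Set A :=
  {x | x + star x = 0 ∧ x * star x = 1}

/-- The quadratic cone: the real numbers, together with all `x` whose trace and squared norm
are real numbers `t`, `q` with `4 q > t ^ 2`. -/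
def quadraticCone (A : Type*) [NonAssocRing A] [StarRing A] [Module ℝ A] : Set A :=
  {x | (∃ r : ℝ, x = r • (1 : A)) ∨
    ∃ t q : ℝ, x + star x = t • (1 : A) ∧ x * star x = q • (1 : A) ∧ t ^ 2 < 4 * q}

/-- A hypercomplex subspace: a real subspace `M` with `ℝ ⊊ M ⊆ Q_A`. -/
structure IsHypercomplexSubspace {A : Type*} [NonAssocRing A] [StarRing A] [Module ℝ A]
    (M : Submodule ℝ A) : Prop where
  real_lt : Submodule.span ℝ {(1 : A)} < M
  subset_cone : (M : Set A) ⊆ quadraticCone A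

/-- `v = (v 0, …, v m)` is a hypercomplex basis of `M`. -/
structure IsHypercomplexBasis {A : Type*} [NonAssocRing A] [StarRing A] [Module ℝ A]
    (M : Submodule ℝ A) {m : ℕ} (v : Fin (m + 1) → A) : Prop where
  one_le : 1 ≤ m
  linearIndependent : LinearIndependent ℝ v
  span_eq : Submodule.span ℝ (Set.range v) = M
  zero_eq : v 0 = 1
  mem_units : ∀ s, s ≠ 0 → v s ∈ imaginaryUnits A
  anticomm : ∀ s t, s ≠ 0 → t ≠ 0 → s ≠ t → v s * v t = -(v t * v s)

/-- The space `ℝ^((m+1)n)`, with coordinates `x (j, s)`. Given a basis `v` of `M` it is identified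
with `Mⁿ`: the `j`-th component of `x` is `∑ s, x (j, s) • v s`. -/
abbrev HypercomplexSpace (n m : ℕ) : Type := EuclideanSpace ℝ (Fin n × Fin (m + 1))

section

variable {A : Type*} [NonAssocRing A] [Module ℝ A] {n m d : ℕ}

/-- `f` is of class `C¹` on the open set `U`: all its real components with respect to the basis
`b` of `A` are. -/
def IsC1On (b : Module.Basis (Fin d) ℝ A) (f : HypercomplexSpace n m → A)
    (U : Set (HypercomplexSpace n m)) : Prop :=
  ∀ t, ContDiffOn ℝ 1 (fun x => b.repr (f x) t) U

/-- The partial derivative `∂f/∂x_{j,s} (x) = ∑ t, (∂f_t/∂x_{j,s}) (x) • b t`. -/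
noncomputable def partialDeriv (b : Module.Basis (Fin d) ℝ A) (f : HypercomplexSpace n m → A)
    (j : Fin n) (s : Fin (m + 1)) (x : HypercomplexSpace n m) : A :=
  ∑ t, (fderiv ℝ (fun y => b.repr (f y) t) x (EuclideanSpace.single (j, s) (1 : ℝ))) • b t

/-- `f` is left monogenic with respect to `v` on the open set `U`: it is `C¹` and
`∑ s, v s * ∂f/∂x_{j,s} = 0` on `U` for every `j`. -/
def IsLeftMonogenicOn (b : Module.Basis (Fin d) ℝ A) (v : Fin (m + 1) → A)
    (f : HypercomplexSpace n m → A) (U : Set (HypercomplexSpace n m)) : Prop :=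
  IsC1On b f U ∧ ∀ x ∈ U, ∀ j : Fin n, ∑ s, v s * partialDeriv b f j s x = 0

/-- `f` is right monogenic with respect to `v` on the open set `U`: it is `C¹` and
`∑ s, ∂f/∂x_{j,s} * v s = 0` on `U` for every `j`. -/
def IsRightMonogenicOn (b : Module.Basis (Fin d) ℝ A) (v : Fin (m + 1) → A)
    (f : HypercomplexSpace n m → A) (U : Set (HypercomplexSpace n m)) : Prop :=
  IsC1On b f U ∧ ∀ x ∈ U, ∀ j : Fin n, ∑ s, partialDeriv b f j s x * v s = 0

end

/-!
Hartogs' theorem for monogenic functions of several hypercomplex variables.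

Left multiplications by the elements of a hypercomplex basis are real linear maps of the algebra.
By alternativity the relations `v s * v s = -1` and `v s * v t = -(v t * v s)` pass to these maps,
so that `v 1, …, v m` act as anticommuting complex structures; the same holds on the right. So both
parts of the theorem concern a first order system `∑ s, T s (∂f/∂x_{j,s}) = 0` whose coefficients
satisfy the polarized Clifford relations
`IsCliffordPair`, and associativity plays no role. Composing with the conjugate operators shows that
every real component of a solution is harmonic in each block `(x_{j,0}, …, x_{j,m})` of variables
separately. For functions of class `C¹` this holds at first in the weak sense, and the radial mean
value property `IsWeaklyHarmonicOn.integral_mul_radialWeight` then gives smoothness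
(`isHarmonicInOn_repr_of_clifford`).

It remains to prove Hartogs' theorem for a real function `f` on `Ω \ K` that is harmonic in each of
at least two blocks (`exists_block_harmonic_extension`). This follows Ehrenpreis' argument. Cut off
`f` near `K` to get `f'` on `Ω`; the partial Laplacians `Δ_j f'` extend by zero to smooth functions
`g j` with compact support and `Δ_i (g j) = Δ_j (g i)`. Because of this compatibility, the Fourier
solution `u` of the full Poisson equation `Δ u = ∑ j, g j` solves `Δ_j u = g j` for every `j` and
tends to zero at infinity (`exists_block_poisson_solution`); this works since the dimension is at
least `4`. Hence `f' - u` is harmonic in each block on all of `Ω`. On a slice in the directions of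
one block that avoids the supports of the `g j`, the function `u` is harmonic and tends to zero, so
it vanishes by Liouville's theorem. Such slices exist because there is a second block, and unique
continuation (`IsHarmonicInOn.eqOn_zero`) carries the vanishing to an open part of `Ω \ K`, so that
`f' - u` extends `f`. Finally the extended components again satisfy the first order system, whose
components are harmonic on `Ω` and vanish on `Ω \ K`.
-/

open scoped ContDiff Topology
open MeasureTheory

/-! ### Directional derivatives, cutoff functions and integration by parts -/

section DirDeriv

variable {E : Type*} [NormedAddCommGroup E] [NormedSpace ℝ E]

/-- The derivative of `f` in the direction `e`, as a function. -/
noncomputable def dirDeriv (e : E) (f : E → ℝ) : E → ℝ := fun x => fderiv ℝ f x e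

theorem ContDiffOn.dirDeriv_of_isOpen {f : E → ℝ} {U : Set E} (hU : IsOpen U) {k l : ℕ∞}
    (hf : ContDiffOn ℝ k f U) (hkl : l + 1 ≤ k) (e : E) :
    ContDiffOn ℝ l (dirDeriv e f) U :=
  (hf.fderiv_of_isOpen hU (by exact_mod_cast hkl)).clm_apply contDiffOn_const

theorem ContDiffOn.dirDeriv_infty {f : E → ℝ} {U : Set E} (hU : IsOpen U)
    (hf : ContDiffOn ℝ ∞ f U) (e : E) : ContDiffOn ℝ ∞ (dirDeriv e f) U :=
  hf.dirDeriv_of_isOpen hU (k := ⊤) (l := ⊤) (by simp) e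

theorem ContDiffOn.continuousOn_dirDeriv {f : E → ℝ} {U : Set E} (hU : IsOpen U)
    (hf : ContDiffOn ℝ 1 f U) (e : E) : ContinuousOn (dirDeriv e f) U :=
  (ContDiffOn.dirDeriv_of_isOpen (k := 1) (l := 0) hU hf (by simp) e).continuousOn

theorem dirDeriv_eqOn {f g : E → ℝ} {U : Set E} (hU : IsOpen U) (h : Set.EqOn f g U) (e : E) :
    Set.EqOn (dirDeriv e f) (dirDeriv e g) U := fun x hx => by
  have : f =ᶠ[𝓝 x] g := h.eventuallyEq_of_mem (hU.mem_nhds hx)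
  simp only [dirDeriv, this.fderiv_eq]

theorem dirDeriv_sub {f g : E → ℝ} {x : E} (hf : DifferentiableAt ℝ f x)
    (hg : DifferentiableAt ℝ g x) (e : E) :
    dirDeriv e (fun y => f y - g y) x = dirDeriv e f x - dirDeriv e g x := by
  simp only [dirDeriv]
  rw [fderiv_fun_sub hf hg]; rfl

theorem dirDeriv_sum {ι : Type*} (s : Finset ι) {f : ι → E → ℝ} {x : E}
    (hf : ∀ i ∈ s, DifferentiableAt ℝ (f i) x) (e : E) :
    dirDeriv e (fun y => ∑ i ∈ s, f i y) x = ∑ i ∈ s, dirDeriv e (f i) x := by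
  simp only [dirDeriv]
  rw [fderiv_fun_sum hf]; simp

theorem dirDeriv_const_mul {f : E → ℝ} {x : E} (hf : DifferentiableAt ℝ f x) (c : ℝ) (e : E) :
    dirDeriv e (fun y => c * f y) x = c * dirDeriv e f x := by
  simp only [dirDeriv]
  rw [fderiv_const_mul hf]; rfl

theorem dirDeriv_comm {f : E → ℝ} {U : Set E} (hU : IsOpen U) (hf : ContDiffOn ℝ ∞ f U)
    (e e' : E) {x : E} (hx : x ∈ U) :
    dirDeriv e (dirDeriv e' f) x = dirDeriv e' (dirDeriv e f) x := by
  have hfx : ContDiffAt ℝ ∞ f x := hf.contDiffAt (hU.mem_nhds hx)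
  have hd : DifferentiableAt ℝ (fderiv ℝ f) x :=
    ((hf.fderiv_of_isOpen hU (m := 1) (by norm_cast)).contDiffAt
      (hU.mem_nhds hx)).differentiableAt (by simp)
  have h2 := hfx.isSymmSndFDerivAt (by simpa using WithTop.coe_le_coe.2 (le_top : (2 : ℕ∞) ≤ ⊤))
  have key : ∀ a b : E, dirDeriv a (dirDeriv b f) x = fderiv ℝ (fderiv ℝ f) x a b := by
    intro a b
    change fderiv ℝ (fun y => fderiv ℝ f y b) x a = _
    rw [fderiv_clm_apply hd (differentiableAt_const b)]
    simp
  rw [key, key]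
  exact h2.eq e e'

theorem tsupport_dirDeriv_subset (f : E → ℝ) (e : E) :
    tsupport (dirDeriv e f) ⊆ tsupport f :=
  (closure_mono (fun x hx => by
    simp only [dirDeriv, Function.mem_support] at hx ⊢
    intro h; exact hx (by rw [h]; rfl))).trans (tsupport_fderiv_subset ℝ)

/-- The chain rule for composition with an affine map. -/
theorem dirDeriv_comp_affine {F : Type*} [NormedAddCommGroup F] [NormedSpace ℝ F] {f : E → ℝ}
    (L : F →L[ℝ] E) (a : E) (e : F) {y : F} (hf : DifferentiableAt ℝ f (a + L y)) :
    dirDeriv e (fun y => f (a + L y)) y = dirDeriv (L e) f (a + L y) := by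
  have h1 : HasFDerivAt (fun y => a + L y) L y := L.hasFDerivAt.const_add a
  have h2 := hf.hasFDerivAt.comp y h1
  simp only [dirDeriv]
  rw [show (fun y => f (a + L y)) = f ∘ (fun y => a + L y) from rfl, h2.fderiv]
  rfl

end DirDeriv

section Integration

theorem continuous_mul_of_tsupport_subset {E : Type*} [TopologicalSpace E] {a g : E → ℝ}
    {U : Set E} (hU : IsOpen U) (ha : ContinuousOn a U) (hg : Continuous g) (hgU : tsupport g ⊆ U) :
    Continuous (fun x => a x * g x) := by
  refine continuous_of_tsupport fun x hx => ?_
  have hx' : x ∈ tsupport g := closure_mono (Function.support_mul_subset_right a g) hx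
  exact (ha.continuousAt (hU.mem_nhds (hgU hx'))).mul hg.continuousAt

variable {E : Type*} [NormedAddCommGroup E] [NormedSpace ℝ E]

theorem contDiff_mul_of_tsupport_subset {a g : E → ℝ} {U : Set E} (hU : IsOpen U) {k : ℕ∞}
    (ha : ContDiffOn ℝ k a U) (hg : ContDiff ℝ k g) (hgU : tsupport g ⊆ U) :
    ContDiff ℝ k (fun x => a x * g x) := by
  refine contDiff_iff_contDiffAt.2 fun x => ?_
  by_cases hx : x ∈ tsupport (fun x => a x * g x)
  swap
  · exact contDiffAt_const.congr_of_eventuallyEq (notMem_tsupport_iff_eventuallyEq.1 hx)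
  have hx' : x ∈ tsupport g := closure_mono (Function.support_mul_subset_right a g) hx
  exact (ha.contDiffAt (hU.mem_nhds (hgU hx'))).mul hg.contDiffAt

theorem exists_smooth_cutoff [FiniteDimensional ℝ E] {K U : Set E} (hK : IsCompact K)
    (hU : IsOpen U) (hKU : K ⊆ U) :
    ∃ η : E → ℝ, ContDiff ℝ ∞ η ∧ HasCompactSupport η ∧ tsupport η ⊆ U ∧
      ∃ V, IsOpen V ∧ K ⊆ V ∧ ∀ x ∈ V, η x = 1 := by
  obtain ⟨L, hL, hKL, hLU⟩ := exists_compact_between hK hU hKU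
  obtain ⟨η, h1, h0, -⟩ := exists_contMDiffMap_one_nhds_of_subset_interior (n := (⊤ : ℕ∞))
    (modelWithCornersSelf ℝ E) hK.isClosed hKL
  have hsub : tsupport η ⊆ L := by
    refine closure_minimal (fun x hx => ?_) hL.isClosed
    by_contra hxL
    exact hx (h0 x hxL)
  obtain ⟨V, hVK, hV⟩ := mem_nhdsSet_iff_exists.1 h1
  exact ⟨η, η.contMDiff.contDiff, hL.of_isClosed_subset (isClosed_tsupport _) hsub,
    hsub.trans hLU, V, hVK, hV.1, fun x hx => hV.2 hx⟩

variable [FiniteDimensional ℝ E] [MeasurableSpace E] [BorelSpace E]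

/-- Integration by parts against a compactly supported function whose support lies in the domain
of the other factor. -/
theorem integral_dirDeriv_mul_eq_neg (μ : MeasureTheory.Measure E) [μ.IsAddHaarMeasure]
    {f ψ : E → ℝ} {U : Set E} (hU : IsOpen U)
    (hf : ContDiffOn ℝ 1 f U) (hψ : ContDiff ℝ 1 ψ) (hc : HasCompactSupport ψ)
    (hψU : tsupport ψ ⊆ U) (e : E) :
    ∫ x, dirDeriv e f x * ψ x ∂μ = - ∫ x, f x * dirDeriv e ψ x ∂μ := by
  have hdψ : Continuous (dirDeriv e ψ) := continuousOn_univ.1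
    (ContDiffOn.continuousOn_dirDeriv isOpen_univ hψ.contDiffOn e)
  have hsub := tsupport_dirDeriv_subset ψ e
  have hdc : HasCompactSupport (dirDeriv e ψ) := hc.of_isClosed_subset (isClosed_tsupport _) hsub
  have h := integral_mul_fderiv_eq_neg_fderiv_mul_of_integrable (μ := μ) (f := f) (g := ψ) (v := e)
    ((continuous_mul_of_tsupport_subset hU (hf.continuousOn_dirDeriv hU e) hψ.continuous
      hψU).integrable_of_hasCompactSupport hc.mul_left)
    ((continuous_mul_of_tsupport_subset hU hf.continuousOn hdψ
      (hsub.trans hψU)).integrable_of_hasCompactSupport hdc.mul_left)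
    ((continuous_mul_of_tsupport_subset hU hf.continuousOn hψ.continuous
      hψU).integrable_of_hasCompactSupport hc.mul_left)
    (fun x hx => (hf.contDiffAt (hU.mem_nhds (hψU hx))).differentiableAt (by simp))
    (fun x _ => hψ.differentiable (by simp) x)
  simp only [dirDeriv] at h ⊢
  rw [h, neg_neg]

end Integration

/-! ### A radial mean value property and the smoothness of weakly harmonic functions -/

section MeanValue

variable {ι : Type*} [Fintype ι]

/-- The partial derivative with respect to the `i`-th coordinate. -/
noncomputable abbrev coordDeriv (i : ι) (f : EuclideanSpace ℝ ι → ℝ) : EuclideanSpace ℝ ι → ℝ :=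
  open Classical in dirDeriv (EuclideanSpace.single i (1 : ℝ)) f

/-- A smooth radial function supported in the closed unit ball. Its gradient at `y` is
`-radialWeight y • y`. -/
noncomputable def radialPotential (y : EuclideanSpace ℝ ι) : ℝ := expNegInvGlue (1 - ‖y‖ ^ 2)

/-- The non-negative radial weight against which mean values are taken. -/
noncomputable def radialWeight (y : EuclideanSpace ℝ ι) : ℝ :=
  2 * deriv expNegInvGlue (1 - ‖y‖ ^ 2)

theorem contDiff_radialPotential : ContDiff ℝ ∞ (radialPotential (ι := ι)) :=
  (expNegInvGlue.contDiff (n := ⊤)).comp (contDiff_const.sub (contDiff_norm_sq ℝ))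

theorem contDiff_radialWeight : ContDiff ℝ ∞ (radialWeight (ι := ι)) :=
  contDiff_const.mul (((contDiff_infty_iff_deriv.1 (expNegInvGlue.contDiff (n := ⊤))).2).comp
    (contDiff_const.sub (contDiff_norm_sq ℝ)))

theorem dirDeriv_radialPotential (y e : EuclideanSpace ℝ ι) :
    dirDeriv e radialPotential y = - (radialWeight y * inner ℝ y e) := by
  have h1 : HasFDerivAt (fun y : EuclideanSpace ℝ ι => 1 - ‖y‖ ^ 2) (-(2 • (innerSL ℝ y))) y :=
    ((hasStrictFDerivAt_norm_sq y).hasFDerivAt).const_sub 1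
  have h2 : HasDerivAt expNegInvGlue (deriv expNegInvGlue (1 - ‖y‖ ^ 2)) (1 - ‖y‖ ^ 2) :=
    ((expNegInvGlue.contDiff (n := ⊤)).differentiable (by simp) _).hasDerivAt
  have h3 := h2.comp_hasFDerivAt y h1
  have h4 : fderiv ℝ radialPotential y = _ := h3.fderiv
  simp only [dirDeriv, h4, radialWeight]
  simp
  ring

theorem radialPotential_eq_zero {y : EuclideanSpace ℝ ι} (hy : 1 ≤ ‖y‖) :
    radialPotential y = 0 :=
  expNegInvGlue.zero_of_nonpos (by nlinarith)

theorem radialWeight_eq_zero {y : EuclideanSpace ℝ ι} (hy : 1 < ‖y‖) : radialWeight y = 0 := by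
  have h : expNegInvGlue =ᶠ[𝓝 (1 - ‖y‖ ^ 2)] fun _ => 0 := by
    filter_upwards [Iio_mem_nhds (show 1 - ‖y‖ ^ 2 < 0 by nlinarith)] with t ht
    exact expNegInvGlue.zero_of_nonpos (le_of_lt ht)
  simp [radialWeight, h.deriv_eq]

theorem radialWeight_nonneg (y : EuclideanSpace ℝ ι) : 0 ≤ radialWeight y :=
  mul_nonneg zero_le_two expNegInvGlue.monotone.deriv_nonneg

theorem radialWeight_neg (y : EuclideanSpace ℝ ι) : radialWeight (-y) = radialWeight y := by
  simp [radialWeight]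

theorem hasCompactSupport_radialWeight : HasCompactSupport (radialWeight (ι := ι)) :=
  HasCompactSupport.intro (isCompact_closedBall 0 1) fun y hy =>
    radialWeight_eq_zero (by simpa using hy)

variable (ι) in
/-- The total mass of the radial weight. -/
noncomputable def radialMass : ℝ := ∫ y : EuclideanSpace ℝ ι, radialWeight y

theorem radialMass_pos [Nonempty ι] : 0 < radialMass ι := by
  classical
  obtain ⟨i⟩ := ‹Nonempty ι›
  by_cases h : ∃ y : EuclideanSpace ℝ ι, radialWeight y ≠ 0
  · obtain ⟨y, hy⟩ := h
    exact contDiff_radialWeight.continuous.integral_pos_of_hasCompactSupport_nonneg_nonzero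
      hasCompactSupport_radialWeight radialWeight_nonneg hy
  -- otherwise the potential would be constant
  · push Not at h
    have hd : ∀ y : EuclideanSpace ℝ ι, fderiv ℝ radialPotential y = 0 := fun y => by
      ext e
      have := dirDeriv_radialPotential y e
      rw [h y, zero_mul, neg_zero] at this
      exact this
    have := is_const_of_fderiv_eq_zero
      (contDiff_radialPotential.differentiable (by simp)) hd 0 (EuclideanSpace.single i (1 : ℝ))
    rw [radialPotential_eq_zero (y := EuclideanSpace.single i (1 : ℝ)) (by simp)] at this
    exact absurd this (by simp [radialPotential])

/-- A function is weakly harmonic on `U` if its gradient is orthogonal, in the `L²` sense, to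
gradients of test functions supported in `U`. -/
def IsWeaklyHarmonicOn (f : EuclideanSpace ℝ ι → ℝ) (U : Set (EuclideanSpace ℝ ι)) : Prop :=
  ∀ ψ : EuclideanSpace ℝ ι → ℝ, ContDiff ℝ ∞ ψ → HasCompactSupport ψ → tsupport ψ ⊆ U →
    ∫ z, ∑ i, coordDeriv i f z * coordDeriv i ψ z = 0

theorem fderiv_apply_eq_sum (f : EuclideanSpace ℝ ι → ℝ) (z y : EuclideanSpace ℝ ι) :
    fderiv ℝ f z y = ∑ i, y i * coordDeriv i f z := by
  classical
  have hy : y = ∑ i, y i • EuclideanSpace.single i (1 : ℝ) := by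
    ext j; simp [Finset.sum_apply, Pi.single_apply]
  conv_lhs => rw [hy]
  simp [coordDeriv, dirDeriv]

theorem coordDeriv_radialPotential (i : ι) (y : EuclideanSpace ℝ ι) :
    coordDeriv i radialPotential y = - (radialWeight y * y i) := by
  classical
  rw [coordDeriv, dirDeriv_radialPotential]
  simp [PiLp.inner_apply]

/-- The derivative in `ρ` of the weighted mean of `g` over the ball of radius `ρ` vanishes when `g`
is weakly harmonic near this ball, because `radialWeight y • y` is a gradient. -/
theorem integral_fderiv_mul_radialWeight_eq_zero {f g : EuclideanSpace ℝ ι → ℝ}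
    {U : Set (EuclideanSpace ℝ ι)} (hw : IsWeaklyHarmonicOn f U) {x : EuclideanSpace ℝ ι}
    {ρ : ℝ} (hρ : 0 < ρ) (hball : Metric.closedBall x ρ ⊆ U)
    (hfg : ∀ z ∈ Metric.closedBall x ρ, fderiv ℝ g z = fderiv ℝ f z) :
    ∫ y, fderiv ℝ g (x + ρ • y) y * radialWeight y = 0 := by
  set ψ : EuclideanSpace ℝ ι → ℝ := fun z => radialPotential (-(ρ⁻¹ • x) + (ρ⁻¹ •
    ContinuousLinearMap.id ℝ (EuclideanSpace ℝ ι)) z) with hψdef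
  have hψ : ∀ y, ψ (x + ρ • y) = radialPotential y := fun y => by
    simp [hψdef, smul_add, smul_smul, hρ.ne']
  have hψsm : ContDiff ℝ ∞ ψ := contDiff_radialPotential.comp
    (contDiff_const.add (ContinuousLinearMap.contDiff _))
  have hz : ∀ z, ∃ y, z = x + ρ • y := fun z =>
    ⟨ρ⁻¹ • (z - x), by simp [smul_smul, hρ.ne']⟩
  have hsupp : tsupport ψ ⊆ Metric.closedBall x ρ := by
    refine closure_minimal (fun z hzs => ?_) Metric.isClosed_closedBall
    obtain ⟨y, rfl⟩ := hz z
    rw [Function.mem_support, hψ] at hzs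
    have : ‖y‖ < 1 := by
      by_contra hy; exact hzs (radialPotential_eq_zero (not_lt.1 hy))
    rw [mem_closedBall_iff_norm, add_sub_cancel_left, norm_smul, Real.norm_of_nonneg hρ.le]
    nlinarith
  have hψc : HasCompactSupport ψ := (isCompact_closedBall x ρ).of_isClosed_subset
    (isClosed_tsupport _) hsupp
  have hψd : ∀ i y, coordDeriv i ψ (x + ρ • y) = - (ρ⁻¹ * (radialWeight y * y i)) := fun i y => by
    rw [hψdef, coordDeriv, dirDeriv_comp_affine _ _ _
      (contDiff_radialPotential.differentiable (by simp) _)]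
    rw [show -(ρ⁻¹ • x) + (ρ⁻¹ • ContinuousLinearMap.id ℝ (EuclideanSpace ℝ ι)) (x + ρ • y) = y by
      simp [smul_add, smul_smul, hρ.ne']]
    have hi := coordDeriv_radialPotential i y
    rw [coordDeriv, dirDeriv_radialPotential] at hi
    rw [dirDeriv_radialPotential, smul_apply, ContinuousLinearMap.id_apply,
      inner_smul_right]
    linear_combination ρ⁻¹ * hi
  have h := hw ψ hψsm hψc (hsupp.trans hball)
  have key : ∀ y, fderiv ℝ g (x + ρ • y) y * radialWeight y =
      (-ρ) * (fun z => ∑ i, coordDeriv i f z * coordDeriv i ψ z) (x + ρ • y) := fun y => by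
    by_cases hy : ‖y‖ ≤ 1
    · have hmem : x + ρ • y ∈ Metric.closedBall x ρ := by
        rw [mem_closedBall_iff_norm, add_sub_cancel_left, norm_smul, Real.norm_of_nonneg hρ.le]
        nlinarith
      rw [hfg _ hmem, fderiv_apply_eq_sum, Finset.sum_mul]
      simp only [hψd, Finset.mul_sum]
      refine Finset.sum_congr rfl fun i _ => ?_
      field_simp
    · simp only [hψd, radialWeight_eq_zero (not_le.1 hy)]
      simp
  simp_rw [key]
  rw [integral_const_mul]
  have h1 := Measure.integral_comp_smul (volume : Measure (EuclideanSpace ℝ ι))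
    (fun y => (fun z => ∑ i, coordDeriv i f z * coordDeriv i ψ z) (x + y)) ρ
  rw [h1, integral_add_left_eq_self (μ := (volume : Measure (EuclideanSpace ℝ ι)))
    (fun z => ∑ i, coordDeriv i f z * coordDeriv i ψ z) x, h]
  simp

/-- **Mean value property** of weakly harmonic functions of class `C¹`, for the radial weight. -/
theorem IsWeaklyHarmonicOn.integral_mul_radialWeight {f : EuclideanSpace ℝ ι → ℝ}
    {U : Set (EuclideanSpace ℝ ι)} (hU : IsOpen U) (hf : ContDiffOn ℝ 1 f U)
    (hw : IsWeaklyHarmonicOn f U) {x : EuclideanSpace ℝ ι} {r : ℝ} (hr : 0 < r)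
    (hball : Metric.closedBall x r ⊆ U) :
    ∫ y, f (x + r • y) * radialWeight y = f x * radialMass ι := by
  obtain ⟨η, hη, hηc, hηU, V, hV, hKV, hηV⟩ :=
    exists_smooth_cutoff (isCompact_closedBall x r) hU hball
  set g : EuclideanSpace ℝ ι → ℝ := fun z => f z * η z with hg
  have hgd : ContDiff ℝ 1 g := contDiff_mul_of_tsupport_subset (k := 1) hU hf
    (hη.of_le (by exact_mod_cast le_top)) hηU
  have hgc : HasCompactSupport g := hηc.mul_left
  have hfgV : Set.EqOn g f V := fun z hz => by simp [hg, hηV z hz]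
  have hfd : ∀ z ∈ Metric.closedBall x r, fderiv ℝ g z = fderiv ℝ f z := fun z hz =>
    (hfgV.eventuallyEq_of_mem (hV.mem_nhds (hKV hz))).fderiv_eq
  obtain ⟨B, hB⟩ := (hgc.fderiv (𝕜 := ℝ)).exists_bound_of_continuous
    (hgd.continuous_fderiv (by simp))
  have hwc := (contDiff_radialWeight (ι := ι)).continuous
  have hcont' : ∀ ρ : ℝ, Continuous fun y : EuclideanSpace ℝ ι =>
      fderiv ℝ g (x + ρ • y) y * radialWeight y := fun ρ =>
    (((hgd.continuous_fderiv (by simp)).comp (by fun_prop)).clm_apply continuous_id).mul hwc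
  have hM : ∀ ρ : ℝ, HasDerivAt (fun ρ : ℝ => ∫ y, g (x + ρ • y) * radialWeight y)
      (∫ y, fderiv ℝ g (x + ρ • y) y * radialWeight y) ρ := fun ρ => by
    refine (hasDerivAt_integral_of_dominated_loc_of_deriv_le (s := Set.univ)
      (F := fun (ρ : ℝ) y => g (x + ρ • y) * radialWeight y)
      (F' := fun (ρ : ℝ) y => fderiv ℝ g (x + ρ • y) y * radialWeight y)
      (bound := fun y => B * radialWeight y) Filter.univ_mem
      (Filter.Eventually.of_forall fun ρ => ?_) ?_ (hcont' ρ).aestronglyMeasurable ?_ ?_ ?_).2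
    · exact ((hgd.continuous.comp (by fun_prop)).mul hwc).aestronglyMeasurable
    · exact ((hgd.continuous.comp (by fun_prop)).mul hwc).integrable_of_hasCompactSupport
        hasCompactSupport_radialWeight.mul_left
    · refine Filter.Eventually.of_forall fun y ρ' _ => ?_
      by_cases hy : ‖y‖ ≤ 1
      · rw [norm_mul, Real.norm_of_nonneg (radialWeight_nonneg y)]
        refine mul_le_mul_of_nonneg_right ?_ (radialWeight_nonneg y)
        calc ‖fderiv ℝ g (x + ρ' • y) y‖ ≤ ‖fderiv ℝ g (x + ρ' • y)‖ * ‖y‖ :=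
              ContinuousLinearMap.le_opNorm _ _
          _ ≤ B * 1 := mul_le_mul (hB _) hy (norm_nonneg _) ((norm_nonneg _).trans (hB x))
          _ = B := mul_one B
      · simp [radialWeight_eq_zero (not_le.1 hy)]
    · exact (continuous_const.mul hwc).integrable_of_hasCompactSupport
        hasCompactSupport_radialWeight.mul_left
    · refine Filter.Eventually.of_forall fun y ρ' _ => ?_
      have h1 : HasDerivAt (fun ρ : ℝ => x + ρ • y) y ρ' := by
        simpa using ((hasDerivAt_id ρ').smul_const y).const_add x
      exact (((hgd.differentiable (by simp) _).hasFDerivAt).comp_hasDerivAt ρ' h1).mul_const _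
  obtain ⟨ρ, hρ, hslope⟩ := exists_hasDerivAt_eq_slope _ _ hr
    (fun ρ _ => (hM ρ).continuousAt.continuousWithinAt) (fun ρ _ => hM ρ)
  have hsub : Metric.closedBall x ρ ⊆ Metric.closedBall x r :=
    Metric.closedBall_subset_closedBall hρ.2.le
  rw [integral_fderiv_mul_radialWeight_eq_zero hw hρ.1 (hsub.trans hball)
    (fun z hz => hfd z (hsub hz)), eq_comm, div_eq_zero_iff, sub_eq_zero] at hslope
  have h0 := hslope.resolve_right (by linarith)
  have hgx : g x = f x := hfgV (hKV (Metric.mem_closedBall_self hr.le))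
  simp only [zero_smul, add_zero, hgx] at h0
  rw [integral_const_mul] at h0
  rw [radialMass, ← h0]
  refine integral_congr_ae (Filter.Eventually.of_forall fun y => ?_)
  by_cases hy : ‖y‖ ≤ 1
  · have hmem : x + r • y ∈ Metric.closedBall x r := by
      rw [mem_closedBall_iff_norm, add_sub_cancel_left, norm_smul, Real.norm_of_nonneg hr.le]
      nlinarith
    simp only [hfgV (hKV hmem)]
  · simp [radialWeight_eq_zero (not_le.1 hy)]

/-- **Weyl's lemma** for functions of class `C¹`: near each point such a function is a convolution
with a smooth kernel. -/
theorem IsWeaklyHarmonicOn.contDiffOn [Nonempty ι] {f : EuclideanSpace ℝ ι → ℝ}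
    {U : Set (EuclideanSpace ℝ ι)} (hU : IsOpen U) (hf : ContDiffOn ℝ 1 f U)
    (hw : IsWeaklyHarmonicOn f U) : ContDiffOn ℝ ∞ f U := by
  intro x hx
  refine ContDiffAt.contDiffWithinAt ?_
  obtain ⟨r, hr, hball⟩ := Metric.nhds_basis_closedBall.mem_iff.1 (hU.mem_nhds hx)
  obtain ⟨η, hη, hηc, hηU, V, hV, hKV, hηV⟩ :=
    exists_smooth_cutoff (isCompact_closedBall x r) hU hball
  set g : EuclideanSpace ℝ ι → ℝ := fun z => f z * η z with hg
  have hgd : Continuous g := continuous_mul_of_tsupport_subset hU hf.continuousOn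
    hη.continuous hηU
  set s : ℝ := r / 2
  have hs : 0 < s := half_pos hr
  set κ : EuclideanSpace ℝ ι → ℝ := fun w => radialWeight (s⁻¹ • w) with hκ
  have hκd : ContDiff ℝ ∞ κ := contDiff_radialWeight.comp (contDiff_const_smul _)
  have hκc : HasCompactSupport κ :=
    hasCompactSupport_radialWeight.comp_homeomorph (Homeomorph.smulOfNeZero s⁻¹ (by positivity))
  have hconv : ContDiff ℝ ∞ (convolution g κ (ContinuousLinearMap.mul ℝ ℝ) volume) :=
    hκc.contDiff_convolution_right _ (hgd.locallyIntegrable) hκd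
  set c : ℝ := |(s ^ Module.finrank ℝ (EuclideanSpace ℝ ι))⁻¹|
  have heq : f =ᶠ[𝓝 x] fun z => c * (radialMass ι)⁻¹ *
      convolution g κ (ContinuousLinearMap.mul ℝ ℝ) volume z := by
    filter_upwards [Metric.ball_mem_nhds x hs] with z hz
    have hzb : Metric.closedBall z s ⊆ Metric.closedBall x r := by
      refine Metric.closedBall_subset_closedBall' ?_
      have := (Metric.mem_ball.1 hz).le
      simp only [s] at this ⊢
      linarith
    have hmv := hw.integral_mul_radialWeight hU hf hs (hzb.trans hball)
    have h1 : ∫ y, f (z + s • y) * radialWeight y =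
        ∫ y, (fun w => g (z + w) * κ w) (s • y) := by
      refine integral_congr_ae (Filter.Eventually.of_forall fun y => ?_)
      simp only [hκ, smul_smul, inv_mul_cancel₀ hs.ne', one_smul]
      by_cases hy : ‖y‖ ≤ 1
      · have hmem : z + s • y ∈ Metric.closedBall z s := by
          rw [mem_closedBall_iff_norm, add_sub_cancel_left, norm_smul, Real.norm_of_nonneg hs.le]
          nlinarith
        simp only [hg, hηV _ (hKV (hzb hmem)), mul_one]
      · simp [radialWeight_eq_zero (not_le.1 hy)]
    have h2 : ∫ w, g (z + w) * κ w =
        convolution g κ (ContinuousLinearMap.mul ℝ ℝ) volume z := by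
      rw [convolution_def, ← integral_add_left_eq_self
        (fun t => ContinuousLinearMap.mul ℝ ℝ (g t) (κ (z - t))) z]
      refine integral_congr_ae (Filter.Eventually.of_forall fun w => ?_)
      simp [hκ, radialWeight_neg]
    rw [h1, Measure.integral_comp_smul volume (fun w => g (z + w) * κ w), h2, smul_eq_mul] at hmv
    have hm := (radialMass_pos (ι := ι)).ne'
    rw [mul_right_comm, hmv, mul_assoc, mul_inv_cancel₀ hm, mul_one]
  exact (contDiffAt_const.mul hconv.contDiffAt).congr_of_eventuallyEq heq

end MeanValue

/-! ### Smooth harmonic functions: unique continuation and Liouville's theorem -/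

section Harmonic

variable {ι : Type*} [Fintype ι]

/-- The sum of the pure second partial derivatives in the coordinates belonging to `s`. -/
noncomputable def partialLaplacian (s : Finset ι) (f : EuclideanSpace ℝ ι → ℝ) :
    EuclideanSpace ℝ ι → ℝ := fun x => ∑ i ∈ s, coordDeriv i (coordDeriv i f) x

theorem ContDiffOn.differentiableAt_infty {E : Type*} [NormedAddCommGroup E] [NormedSpace ℝ E]
    {f : E → ℝ} {U : Set E} (hU : IsOpen U)
    (hf : ContDiffOn ℝ ∞ f U) {x : E} (hx : x ∈ U) : DifferentiableAt ℝ f x :=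
  (hf.contDiffAt (hU.mem_nhds hx)).differentiableAt (by simp)

theorem partialLaplacian_eqOn {f g : EuclideanSpace ℝ ι → ℝ} {U : Set (EuclideanSpace ℝ ι)}
    (hU : IsOpen U) (hfg : Set.EqOn f g U) (s : Finset ι) :
    Set.EqOn (partialLaplacian s f) (partialLaplacian s g) U := fun _ hx =>
  Finset.sum_congr rfl fun _ _ => dirDeriv_eqOn hU (dirDeriv_eqOn hU hfg _) _ hx

theorem partialLaplacian_zero (s : Finset ι) (x : EuclideanSpace ℝ ι) :
    partialLaplacian s (fun _ => 0) x = 0 := by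
  have : ∀ e : EuclideanSpace ℝ ι, dirDeriv e (fun _ => 0) = fun _ => (0 : ℝ) := fun e => by
    funext x; simp [dirDeriv]
  simp [partialLaplacian, coordDeriv, this]

theorem contDiffOn_partialLaplacian {f : EuclideanSpace ℝ ι → ℝ} {U : Set (EuclideanSpace ℝ ι)}
    (hU : IsOpen U) (hf : ContDiffOn ℝ ∞ f U) (s : Finset ι) :
    ContDiffOn ℝ ∞ (partialLaplacian s f) U :=
  ContDiffOn.sum fun _ _ => (hf.dirDeriv_infty hU _).dirDeriv_infty hU _

theorem partialLaplacian_sub {f g : EuclideanSpace ℝ ι → ℝ} {U : Set (EuclideanSpace ℝ ι)}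
    (hU : IsOpen U) (hf : ContDiffOn ℝ ∞ f U) (hg : ContDiffOn ℝ ∞ g U) (s : Finset ι)
    {x : EuclideanSpace ℝ ι} (hx : x ∈ U) :
    partialLaplacian s (fun x => f x - g x) x =
      partialLaplacian s f x - partialLaplacian s g x := by
  simp only [partialLaplacian, ← Finset.sum_sub_distrib]
  refine Finset.sum_congr rfl fun i _ => ?_
  rw [← dirDeriv_sub ((hf.dirDeriv_infty hU _).differentiableAt_infty hU hx)
    ((hg.dirDeriv_infty hU _).differentiableAt_infty hU hx)]
  exact dirDeriv_eqOn hU (fun y hy => dirDeriv_sub (hf.differentiableAt_infty hU hy)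
    (hg.differentiableAt_infty hU hy) _) _ hx

theorem partialLaplacian_sum_const_mul {κ : Type*} (t : Finset κ) (c : κ → ℝ)
    {f : κ → EuclideanSpace ℝ ι → ℝ} {U : Set (EuclideanSpace ℝ ι)} (hU : IsOpen U)
    (hf : ∀ k, ContDiffOn ℝ ∞ (f k) U) (s : Finset ι) {x : EuclideanSpace ℝ ι} (hx : x ∈ U) :
    partialLaplacian s (fun x => ∑ k ∈ t, c k * f k x) x =
      ∑ k ∈ t, c k * partialLaplacian s (f k) x := by
  have key : ∀ (g : κ → EuclideanSpace ℝ ι → ℝ) (_ : ∀ k, ContDiffOn ℝ ∞ (g k) U)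
      (e : EuclideanSpace ℝ ι), Set.EqOn (dirDeriv e fun x => ∑ k ∈ t, c k * g k x)
        (fun x => ∑ k ∈ t, c k * dirDeriv e (g k) x) U := fun g hg e y hy => by
    rw [dirDeriv_sum t fun k _ => ((hg k).differentiableAt_infty hU hy).const_mul _]
    exact Finset.sum_congr rfl fun k _ =>
      dirDeriv_const_mul ((hg k).differentiableAt_infty hU hy) _ _
  have h2 : ∀ i, coordDeriv i (coordDeriv i fun x => ∑ k ∈ t, c k * f k x) x =
      ∑ k ∈ t, c k * coordDeriv i (coordDeriv i (f k)) x := fun i => by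
    refine Eq.trans ?_ (key (fun k => coordDeriv i (f k))
      (fun k => (hf k).dirDeriv_infty hU _) _ hx)
    exact dirDeriv_eqOn hU (key _ hf _) _ hx
  simp only [partialLaplacian, h2, Finset.mul_sum]
  exact Finset.sum_comm

theorem partialLaplacian_dirDeriv {f : EuclideanSpace ℝ ι → ℝ} {U : Set (EuclideanSpace ℝ ι)}
    (hU : IsOpen U) (hf : ContDiffOn ℝ ∞ f U) (s : Finset ι) (e : EuclideanSpace ℝ ι)
    {x : EuclideanSpace ℝ ι} (hx : x ∈ U) :
    partialLaplacian s (dirDeriv e f) x = dirDeriv e (partialLaplacian s f) x := by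
  have hd := fun i : ι => hf.dirDeriv_infty hU (open Classical in EuclideanSpace.single i (1 : ℝ))
  have h1 : ∀ i, coordDeriv i (coordDeriv i (dirDeriv e f)) x =
      dirDeriv e (coordDeriv i (coordDeriv i f)) x := fun i => by
    rw [← dirDeriv_comm hU (hd i) _ _ hx]
    exact dirDeriv_eqOn hU (fun y hy => dirDeriv_comm hU hf _ _ hy) _ hx
  simp only [partialLaplacian, h1]
  exact (dirDeriv_sum s (fun i _ => ((hd i).dirDeriv_infty hU _).differentiableAt_infty hU hx)
    e).symm

theorem partialLaplacian_comm {f : EuclideanSpace ℝ ι → ℝ} {U : Set (EuclideanSpace ℝ ι)}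
    (hU : IsOpen U) (hf : ContDiffOn ℝ ∞ f U) (s t : Finset ι) {x : EuclideanSpace ℝ ι}
    (hx : x ∈ U) :
    partialLaplacian s (partialLaplacian t f) x = partialLaplacian t (partialLaplacian s f) x := by
  have h1 := partialLaplacian_sum_const_mul s (fun _ => 1) hU
    (fun i => (hf.dirDeriv_infty hU (open Classical in
      EuclideanSpace.single i (1 : ℝ))).dirDeriv_infty hU (open Classical in
      EuclideanSpace.single i (1 : ℝ))) t hx
  simp only [one_mul] at h1
  refine Eq.trans ?_ h1.symm
  refine Finset.sum_congr rfl fun i _ => ?_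
  rw [partialLaplacian_dirDeriv hU (hf.dirDeriv_infty hU _) t _ hx]
  exact dirDeriv_eqOn hU (fun y hy => (partialLaplacian_dirDeriv hU hf t _ hy).symm) _ hx

/-- `f` is smooth on `U` and annihilated there by the partial Laplacian in the coordinates
belonging to `s`. For `s = Finset.univ` this is harmonicity, for a block of coordinates it is
harmonicity in these coordinates separately. -/
structure IsHarmonicInOn (s : Finset ι) (f : EuclideanSpace ℝ ι → ℝ)
    (U : Set (EuclideanSpace ℝ ι)) : Prop where
  contDiffOn : ContDiffOn ℝ ∞ f U
  partialLaplacian_eq_zero : ∀ x ∈ U, partialLaplacian s f x = 0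

theorem IsHarmonicInOn.mono {s : Finset ι} {f : EuclideanSpace ℝ ι → ℝ}
    {U V : Set (EuclideanSpace ℝ ι)} (h : IsHarmonicInOn s f U) (hVU : V ⊆ U) :
    IsHarmonicInOn s f V :=
  ⟨h.contDiffOn.mono hVU, fun x hx => h.partialLaplacian_eq_zero x (hVU hx)⟩

theorem IsHarmonicInOn.dirDeriv_of_isOpen {s : Finset ι} {f : EuclideanSpace ℝ ι → ℝ}
    {U : Set (EuclideanSpace ℝ ι)} (hU : IsOpen U) (h : IsHarmonicInOn s f U)
    (e : EuclideanSpace ℝ ι) : IsHarmonicInOn s (dirDeriv e f) U := by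
  refine ⟨h.contDiffOn.dirDeriv_infty hU e, fun x hx => ?_⟩
  rw [partialLaplacian_dirDeriv hU h.contDiffOn s e hx,
    dirDeriv_eqOn hU (g := fun _ => 0) h.partialLaplacian_eq_zero e hx]
  simp [dirDeriv]

theorem IsHarmonicInOn.sub {s : Finset ι} {f g : EuclideanSpace ℝ ι → ℝ}
    {U : Set (EuclideanSpace ℝ ι)} (hU : IsOpen U) (hf : IsHarmonicInOn s f U)
    (hg : IsHarmonicInOn s g U) : IsHarmonicInOn s (fun x => f x - g x) U :=
  ⟨hf.contDiffOn.sub hg.contDiffOn, fun x hx => by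
    rw [partialLaplacian_sub hU hf.contDiffOn hg.contDiffOn s hx,
      hf.partialLaplacian_eq_zero x hx, hg.partialLaplacian_eq_zero x hx, sub_zero]⟩

theorem IsHarmonicInOn.sum_const_mul {κ : Type*} (t : Finset κ) (c : κ → ℝ) {s : Finset ι}
    {f : κ → EuclideanSpace ℝ ι → ℝ} {U : Set (EuclideanSpace ℝ ι)} (hU : IsOpen U)
    (hf : ∀ k, IsHarmonicInOn s (f k) U) :
    IsHarmonicInOn s (fun x => ∑ k ∈ t, c k * f k x) U :=
  ⟨ContDiffOn.sum fun k _ => contDiffOn_const.mul (hf k).contDiffOn, fun x hx => by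
    rw [partialLaplacian_sum_const_mul t c hU (fun k => (hf k).contDiffOn) s hx]
    exact Finset.sum_eq_zero fun k _ => by
      rw [(hf k).partialLaplacian_eq_zero x hx, mul_zero]⟩

/-- A function that is harmonic in each block of a partition of the coordinates is harmonic. -/
theorem IsHarmonicInOn.of_blocks {κ σ : Type*} [Fintype κ] [Fintype σ]
    {f : EuclideanSpace ℝ (κ × σ) → ℝ} {U : Set (EuclideanSpace ℝ (κ × σ))} [Nonempty κ]
    (h : ∀ j, IsHarmonicInOn ({j} ×ˢ Finset.univ) f U) :
    IsHarmonicInOn Finset.univ f U := by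
  refine ⟨(h (Classical.arbitrary κ)).contDiffOn, fun x hx => ?_⟩
  rw [partialLaplacian, ← Finset.univ_product_univ, Finset.sum_product]
  refine Finset.sum_eq_zero fun j _ => ?_
  have := (h j).partialLaplacian_eq_zero x hx
  rwa [partialLaplacian, Finset.sum_product, Finset.sum_singleton] at this

theorem IsHarmonicInOn.isWeaklyHarmonicOn {f : EuclideanSpace ℝ ι → ℝ}
    {U : Set (EuclideanSpace ℝ ι)} (hU : IsOpen U) (h : IsHarmonicInOn Finset.univ f U) :
    IsWeaklyHarmonicOn f U := by
  intro ψ hψ hc hψU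
  have hψ1 : ContDiff ℝ 1 ψ := hψ.of_le (by exact_mod_cast le_top)
  have hd := fun i : ι => h.contDiffOn.dirDeriv_infty hU (open Classical in
    EuclideanSpace.single i (1 : ℝ))
  have hd1 := fun i : ι => (hd i).of_le (show (1 : ℕ∞ω) ≤ ∞ by exact_mod_cast le_top)
  have hint : ∀ i, Integrable (fun z => coordDeriv i f z * coordDeriv i ψ z) := fun i =>
    (continuous_mul_of_tsupport_subset hU (hd i).continuousOn
      (continuousOn_univ.1 (ContDiffOn.continuousOn_dirDeriv isOpen_univ hψ1.contDiffOn _))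
      ((tsupport_dirDeriv_subset ψ _).trans hψU)).integrable_of_hasCompactSupport
      (HasCompactSupport.mul_left
        (hc.of_isClosed_subset (isClosed_tsupport _) (tsupport_dirDeriv_subset ψ _)))
  have hint2 : ∀ i, Integrable (fun z => coordDeriv i (coordDeriv i f) z * ψ z) := fun i =>
    (continuous_mul_of_tsupport_subset hU ((hd1 i).continuousOn_dirDeriv hU _)
      hψ.continuous hψU).integrable_of_hasCompactSupport hc.mul_left
  rw [integral_finsetSum _ fun i _ => hint i]
  have : ∀ i, ∫ z, coordDeriv i f z * coordDeriv i ψ z =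
      -∫ z, coordDeriv i (coordDeriv i f) z * ψ z := fun i => by
    rw [integral_dirDeriv_mul_eq_neg volume hU (hd1 i) hψ1 hc hψU, neg_neg]
  simp_rw [this]
  rw [Finset.sum_neg_distrib, ← integral_finsetSum _ fun i _ => hint2 i, neg_eq_zero]
  refine integral_eq_zero_of_ae (Filter.Eventually.of_forall fun z => ?_)
  simp only [Pi.zero_apply]
  by_cases hz : z ∈ U
  · rw [← Finset.sum_mul, show ∑ i, coordDeriv i (coordDeriv i f) z = 0 from
      h.partialLaplacian_eq_zero z hz, zero_mul]
  · have : ψ z = 0 := by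
      by_contra h0; exact hz (hψU (subset_tsupport ψ h0))
    simp [this]

theorem IsHarmonicInOn.mean_value {f : EuclideanSpace ℝ ι → ℝ} {U : Set (EuclideanSpace ℝ ι)}
    (hU : IsOpen U) (h : IsHarmonicInOn Finset.univ f U) {x : EuclideanSpace ℝ ι} {r : ℝ}
    (hr : 0 < r) (hball : Metric.closedBall x r ⊆ U) :
    ∫ y, f (x + r • y) * radialWeight y = f x * radialMass ι :=
  (h.isWeaklyHarmonicOn hU).integral_mul_radialWeight hU
    (h.contDiffOn.of_le (by exact_mod_cast le_top)) hr hball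

/-- **Liouville's theorem**: a harmonic function on the whole space that tends to zero at infinity
vanishes. The mean values over balls of growing radius tend to zero by dominated convergence. -/
theorem IsHarmonicInOn.eq_zero_of_tendsto_zero [Nonempty ι] {f : EuclideanSpace ℝ ι → ℝ}
    (h : IsHarmonicInOn Finset.univ f Set.univ)
    (h0 : Filter.Tendsto f (Filter.cocompact _) (𝓝 0)) (x : EuclideanSpace ℝ ι) : f x = 0 := by
  have hfc : Continuous f := continuousOn_univ.1 h.contDiffOn.continuousOn
  obtain ⟨B, hB⟩ : ∃ B, ∀ z, ‖f z‖ ≤ B := by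
    have hev : ∀ᶠ z in Filter.cocompact _, ‖f z‖ ≤ 1 := by
      filter_upwards [h0.norm.eventually (Iio_mem_nhds (by simp : ‖(0 : ℝ)‖ < 1))] with z hz
      exact hz.le
    obtain ⟨K, hK, hKs⟩ := Filter.mem_cocompact.1 hev
    obtain ⟨C, hC⟩ := hK.exists_bound_of_continuousOn hfc.continuousOn
    refine ⟨max 1 C, fun z => ?_⟩
    by_cases hz : z ∈ K
    · exact (hC z hz).trans (le_max_right _ _)
    · exact (hKs hz : ‖f z‖ ≤ 1).trans (le_max_left _ _)
  have hwc := (contDiff_radialWeight (ι := ι)).continuous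
  have hlim : Filter.Tendsto (fun n : ℕ => ∫ y, f (x + (n : ℝ) • y) * radialWeight y)
      Filter.atTop (𝓝 (∫ _ : EuclideanSpace ℝ ι, (0 : ℝ))) := by
    refine tendsto_integral_of_dominated_convergence (fun y => B * radialWeight y)
      (fun n => ((hfc.comp (by fun_prop)).mul hwc).aestronglyMeasurable)
      ((continuous_const.mul hwc).integrable_of_hasCompactSupport
        hasCompactSupport_radialWeight.mul_left) (fun n => Filter.Eventually.of_forall fun y => ?_)
      ?_
    · rw [norm_mul, Real.norm_of_nonneg (radialWeight_nonneg y)]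
      exact mul_le_mul_of_nonneg_right (hB _) (radialWeight_nonneg y)
    · have hne : ∀ᵐ y : EuclideanSpace ℝ ι, y ≠ 0 := by
        simp [ae_iff]
      filter_upwards [hne] with y hy
      have : Filter.Tendsto (fun n : ℕ => x + (n : ℝ) • y) Filter.atTop
          (Filter.cocompact (EuclideanSpace ℝ ι)) := by
        rw [← Metric.cobounded_eq_cocompact, ← comap_norm_atTop, Filter.tendsto_comap_iff]
        have h1 : Filter.Tendsto (fun n : ℕ => (n : ℝ) * ‖y‖ - ‖x‖) Filter.atTop Filter.atTop :=
          Filter.tendsto_atTop_add_const_right _ _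
            (tendsto_natCast_atTop_atTop.atTop_mul_const (norm_pos_iff.2 hy))
        refine Filter.tendsto_atTop_mono (fun n => ?_) h1
        have := norm_sub_le (x + (n : ℝ) • y) x
        rw [add_sub_cancel_left, norm_smul, Real.norm_natCast] at this
        rw [Function.comp_apply]
        linarith
      simpa using (h0.comp this).mul_const (radialWeight y)
  have hconst : ∀ᶠ n : ℕ in Filter.atTop,
      ∫ y, f (x + (n : ℝ) • y) * radialWeight y = f x * radialMass ι := by
    filter_upwards [Filter.eventually_gt_atTop 0] with n hn
    exact h.mean_value isOpen_univ (by exact_mod_cast hn) (Set.subset_univ _)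
  have := tendsto_nhds_unique (hlim.congr' hconst) tendsto_const_nhds
  rw [integral_zero] at this
  exact (mul_eq_zero.1 this.symm).resolve_right radialMass_pos.ne'

/-- The gradient estimate for harmonic functions, from integration by parts in the mean value
property of the derivative. -/
theorem IsHarmonicInOn.exists_norm_dirDeriv_le [Nonempty ι] : ∃ C : ℝ, 0 < C ∧
    ∀ {f : EuclideanSpace ℝ ι → ℝ} {U : Set (EuclideanSpace ℝ ι)}, IsOpen U →
      IsHarmonicInOn Finset.univ f U → ∀ {x e : EuclideanSpace ℝ ι} {r M : ℝ}, 0 < r →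
      Metric.closedBall x r ⊆ U → (∀ z ∈ Metric.closedBall x r, |f z| ≤ M) →
      |dirDeriv e f x| ≤ C * ‖e‖ / r * M := by
  have hW := contDiff_radialWeight (ι := ι)
  have hW1 : ContDiff ℝ 1 (radialWeight (ι := ι)) := hW.of_le (by exact_mod_cast le_top)
  have hWc := hasCompactSupport_radialWeight (ι := ι)
  set I : ℝ := ∫ y : EuclideanSpace ℝ ι, ‖fderiv ℝ radialWeight y‖ with hI
  have hI0 : 0 ≤ I := integral_nonneg fun _ => norm_nonneg _
  have hm := radialMass_pos (ι := ι)
  refine ⟨(I + 1) / radialMass ι, by positivity, ?_⟩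
  intro f U hU h x e r M hr hball hM
  have hM0 : 0 ≤ M := (abs_nonneg _).trans (hM x (Metric.mem_closedBall_self hr.le))
  have hmv := (h.dirDeriv_of_isOpen hU e).mean_value hU hr hball
  -- the mean value formula is rewritten in terms of the rescaled function `F`
  set T : EuclideanSpace ℝ ι →L[ℝ] EuclideanSpace ℝ ι := r • ContinuousLinearMap.id ℝ _ with hT
  set F : EuclideanSpace ℝ ι → ℝ := fun y => f (x + T y) with hF
  set V : Set (EuclideanSpace ℝ ι) := (fun y => x + T y) ⁻¹' U
  have hV : IsOpen V := hU.preimage (by fun_prop)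
  have hFd : ContDiffOn ℝ 1 F V := by
    refine (h.contDiffOn.of_le (by exact_mod_cast le_top)).comp (t := U) ?_ fun y hy => hy
    exact (contDiff_const.add T.contDiff).contDiffOn
  have hmem : ∀ y : EuclideanSpace ℝ ι, ‖y‖ ≤ 1 → x + T y ∈ Metric.closedBall x r := fun y hy => by
    rw [mem_closedBall_iff_norm, add_sub_cancel_left, hT]
    simp only [smul_apply, ContinuousLinearMap.id_apply, norm_smul]
    rw [Real.norm_of_nonneg hr.le]
    nlinarith
  have hsupp : tsupport (radialWeight (ι := ι)) ⊆ Metric.closedBall 0 1 := by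
    refine closure_minimal (fun y hy => ?_) Metric.isClosed_closedBall
    by_contra hy'
    exact hy (radialWeight_eq_zero (by simpa using hy'))
  have hsuppV : tsupport (radialWeight (ι := ι)) ⊆ V := fun y hy =>
    hball (hmem y (by simpa using hsupp hy))
  have hibp := integral_dirDeriv_mul_eq_neg volume hV hFd hW1 hWc hsuppV e
  have hFe : ∀ y, dirDeriv e F y * radialWeight y =
      r * (dirDeriv e f (x + r • y) * radialWeight y) := fun y => by
    by_cases hy : ‖y‖ ≤ 1
    · rw [hF, dirDeriv_comp_affine T x e
        (h.contDiffOn.differentiableAt_infty hU (hball (hmem y hy)))]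
      simp [hT, dirDeriv, mul_assoc]
    · simp [radialWeight_eq_zero (not_le.1 hy)]
  simp_rw [hFe] at hibp
  rw [integral_const_mul, hmv] at hibp
  have hbound : |∫ y, F y * dirDeriv e radialWeight y| ≤ M * ‖e‖ * I := by
    rw [hI, ← integral_const_mul, ← Real.norm_eq_abs]
    have hint : Integrable fun y : EuclideanSpace ℝ ι =>
        M * ‖e‖ * ‖fderiv ℝ (radialWeight (ι := ι)) y‖ :=
      (continuous_const.mul (hW1.continuous_fderiv (by simp)).norm).integrable_of_hasCompactSupport
        (HasCompactSupport.mul_left (hWc.fderiv (𝕜 := ℝ)).norm)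
    refine norm_integral_le_of_norm_le hint (Filter.Eventually.of_forall fun y => ?_)
    · by_cases hy : ‖y‖ ≤ 1
      · rw [norm_mul, mul_assoc, mul_comm ‖e‖]
        exact mul_le_mul (hM _ (hmem y hy)) ((fderiv ℝ radialWeight y).le_opNorm e)
          (norm_nonneg _) hM0
      · have : dirDeriv e radialWeight y = 0 := by
          by_contra h0
          have h2 := hsupp (tsupport_dirDeriv_subset radialWeight e (subset_tsupport _ h0))
          exact hy (by simpa using h2)
        rw [this, mul_zero, norm_zero]
        positivity
  have h1 : r * |dirDeriv e f x| * radialMass ι ≤ M * ‖e‖ * I := by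
    have := congrArg abs hibp
    rw [abs_neg, abs_mul, abs_mul, abs_of_pos hm, abs_of_pos hr] at this
    linarith
  rw [show (I + 1) / radialMass ι * ‖e‖ / r * M = ((I + 1) * (M * ‖e‖)) / (r * radialMass ι) by
    field_simp, le_div_iff₀ (by positivity)]
  nlinarith [mul_nonneg hM0 (norm_nonneg e)]

/-- The analytic estimates for the iterated derivatives of a harmonic function in a fixed
direction. -/
theorem IsHarmonicInOn.abs_iterate_dirDeriv_le {C : ℝ}
    (hgrad : ∀ {f : EuclideanSpace ℝ ι → ℝ} {U : Set (EuclideanSpace ℝ ι)}, IsOpen U →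
      IsHarmonicInOn Finset.univ f U → ∀ {x e : EuclideanSpace ℝ ι} {r M : ℝ}, 0 < r →
      Metric.closedBall x r ⊆ U → (∀ z ∈ Metric.closedBall x r, |f z| ≤ M) →
      |dirDeriv e f x| ≤ C * ‖e‖ / r * M)
    {U : Set (EuclideanSpace ℝ ι)} (hU : IsOpen U) {x e : EuclideanSpace ℝ ι} {s : ℝ} (hs : 0 < s)
    (k : ℕ) : ∀ {f : EuclideanSpace ℝ ι → ℝ} {M : ℝ}, IsHarmonicInOn Finset.univ f U →
      Metric.closedBall x (k * s) ⊆ U → (∀ z ∈ Metric.closedBall x (k * s), |f z| ≤ M) →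
      |(dirDeriv e)^[k] f x| ≤ (C * ‖e‖ / s) ^ k * M := by
  induction k with
  | zero => intro f M _ _ hM; simpa using hM x (by simp)
  | succ k ih =>
    intro f M h hball hM
    have hsub : ∀ y ∈ Metric.closedBall x (k * s),
        Metric.closedBall y s ⊆ Metric.closedBall x ((k + 1 : ℕ) * s) := fun y hy => by
      refine Metric.closedBall_subset_closedBall' ?_
      have := Metric.mem_closedBall.1 hy
      push_cast
      linarith
    have hsub' : Metric.closedBall x (k * s) ⊆ Metric.closedBall x ((k + 1 : ℕ) * s) :=
      fun y hy => hsub y hy (Metric.mem_closedBall_self hs.le)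
    have := ih (M := C * ‖e‖ / s * M) (h.dirDeriv_of_isOpen hU e) (hsub'.trans hball)
      (fun y hy => hgrad hU h hs ((hsub y hy).trans hball) fun z hz => hM z (hsub y hy hz))
    rw [Function.iterate_succ_apply, pow_succ, mul_assoc]
    exact this

/-- Taylor's estimate for a chain of successive derivatives vanishing at the origin. -/
theorem abs_le_of_iterated_hasDerivAt (n : ℕ) : ∀ {g : ℕ → ℝ → ℝ} {B : ℝ},
    (∀ k < n, ∀ t ∈ Set.Icc (0 : ℝ) 1, HasDerivAt (g k) (g (k + 1) t) t) →
    (∀ k < n, g k 0 = 0) → (∀ t ∈ Set.Icc (0 : ℝ) 1, |g n t| ≤ B) →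
    ∀ t ∈ Set.Icc (0 : ℝ) 1, |g 0 t| ≤ B * (t ^ n / n.factorial) := by
  induction n with
  | zero => intro g B _ _ hB t ht; simpa using hB t ht
  | succ n ih =>
    intro g B hd h0 hB
    have h1 := ih (g := fun k => g (k + 1)) (fun k hk => hd (k + 1) (by omega))
      (fun k hk => h0 (k + 1) (by omega)) hB
    have hder : ∀ t : ℝ, HasDerivAt (fun t => B * (t ^ (n + 1) / (n + 1).factorial))
        (B * (t ^ n / n.factorial)) t := fun t => by
      have := ((hasDerivAt_pow (n + 1) t).div_const ((n + 1).factorial : ℝ)).const_mul B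
      refine this.congr_deriv ?_
      rw [Nat.factorial_succ]
      push_cast
      have : (n.factorial : ℝ) ≠ 0 := by positivity
      field_simp
    intro t ht
    exact image_norm_le_of_norm_deriv_right_le_deriv_boundary (f := g 0) (f' := g 1)
      (fun t ht => (hd 0 (by omega) t ht).continuousAt.continuousWithinAt)
      (fun t ht => (hd 0 (by omega) t ⟨ht.1, ht.2.le⟩).hasDerivWithinAt)
      (by simp [h0 0 (by omega)]) hder (fun t ht => h1 t ⟨ht.1, ht.2.le⟩) ht

theorem iterate_dirDeriv_eventuallyEq_zero {f : EuclideanSpace ℝ ι → ℝ} {z : EuclideanSpace ℝ ι}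
    (hf : f =ᶠ[𝓝 z] 0) (e : EuclideanSpace ℝ ι) (k : ℕ) : (dirDeriv e)^[k] f =ᶠ[𝓝 z] 0 := by
  induction k with
  | zero => exact hf
  | succ k ih =>
    rw [Function.iterate_succ_apply']
    obtain ⟨V, hV, hVo, hzV⟩ := eventually_nhds_iff.1 ih
    refine Set.EqOn.eventuallyEq_of_mem (s := V) (fun y hy => ?_) (hVo.mem_nhds hzV)
    rw [dirDeriv_eqOn hVo (g := fun _ => 0) hV e hy]
    simp [dirDeriv]

theorem IsHarmonicInOn.iterate_dirDeriv {f : EuclideanSpace ℝ ι → ℝ}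
    {U : Set (EuclideanSpace ℝ ι)} (hU : IsOpen U) {s : Finset ι} (h : IsHarmonicInOn s f U)
    (e : EuclideanSpace ℝ ι) (k : ℕ) : IsHarmonicInOn s ((dirDeriv e)^[k] f) U := by
  induction k with
  | zero => exact h
  | succ k ih => rw [Function.iterate_succ_apply']; exact ih.dirDeriv_of_isOpen hU e

/-- Near each point of its domain, a harmonic function has a radius within which vanishing
propagates from one point to all others. -/
theorem IsHarmonicInOn.exists_ball_eq_zero [Nonempty ι] {f : EuclideanSpace ℝ ι → ℝ}
    {U : Set (EuclideanSpace ℝ ι)} (hU : IsOpen U) (h : IsHarmonicInOn Finset.univ f U)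
    {x : EuclideanSpace ℝ ι} (hx : x ∈ U) :
    ∃ δ > 0, ∀ z ∈ Metric.ball x δ, f =ᶠ[𝓝 z] 0 → ∀ y ∈ Metric.ball x δ, f y = 0 := by
  obtain ⟨C, hC, hgrad⟩ := IsHarmonicInOn.exists_norm_dirDeriv_le (ι := ι)
  obtain ⟨r, hr, hball⟩ := Metric.nhds_basis_closedBall.mem_iff.1 (hU.mem_nhds hx)
  obtain ⟨M, hM⟩ := (isCompact_closedBall x r).exists_bound_of_continuousOn
    (h.contDiffOn.continuousOn.mono hball)
  have hM0 : 0 ≤ M := (norm_nonneg _).trans (hM x (Metric.mem_closedBall_self hr.le))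
  set R : ℝ := r / 2 with hR
  have hR0 : 0 < R := half_pos hr
  -- the ratio of the geometric series bounding the Taylor remainders is at most `1 / 2`
  set δ : ℝ := min R (R / (4 * C * Real.exp 1))
  have hδ : 0 < δ := lt_min hR0 (by positivity)
  have hδ' : C * (2 * δ) * Real.exp 1 / R ≤ 1 / 2 := by
    have : δ ≤ R / (4 * C * Real.exp 1) := min_le_right _ _
    rw [le_div_iff₀ (by positivity)] at this
    rw [div_le_iff₀ hR0]
    linarith
  refine ⟨δ, hδ, fun z hz hfz y hy => ?_⟩
  set e := y - z with he
  have hen : ‖e‖ ≤ 2 * δ := by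
    rw [he, ← dist_eq_norm]
    have h1 := Metric.mem_ball.1 hy
    have h2 := Metric.mem_ball'.1 hz
    linarith [dist_triangle y x z]
  have hseg : ∀ t ∈ Set.Icc (0 : ℝ) 1, z + t • e ∈ Metric.ball x δ := fun t ht =>
    (convex_ball x δ).add_smul_sub_mem hz hy ht
  have hballt : ∀ t ∈ Set.Icc (0 : ℝ) 1,
      Metric.closedBall (z + t • e) R ⊆ Metric.closedBall x r := fun t ht => by
    refine Metric.closedBall_subset_closedBall' ?_
    have := Metric.mem_ball.1 (hseg t ht)
    have hδR : δ ≤ R := min_le_left _ _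
    linarith
  have hbound : ∀ n : ℕ, 0 < n → |f y| ≤ (1 / 2) ^ n * M := fun n hn => by
    have hn' : (0 : ℝ) < n := by exact_mod_cast hn
    have hnR : (n : ℝ) * (R / n) = R := by field_simp
    have hder := abs_le_of_iterated_hasDerivAt n
      (g := fun k t => (dirDeriv e)^[k] f (z + t • e)) (B := (C * ‖e‖ / (R / n)) ^ n * M)
      (fun k _ t ht => ?_) (fun k _ => ?_) (fun t ht => ?_) 1 (by simp)
    · simp only [Function.iterate_zero, id, one_smul, he, add_sub_cancel, one_pow] at hder
      refine hder.trans ?_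
      have hfac := Real.pow_div_factorial_le_exp n (Nat.cast_nonneg n) n
      have hkey : (C * ‖y - z‖ / (R / n)) ^ n * M * (1 / n.factorial) =
          (C * ‖y - z‖ / R) ^ n * M * ((n : ℝ) ^ n / n.factorial) := by
        rw [div_div_eq_mul_div, div_pow (_ * (n : ℝ)), div_pow _ R, mul_pow _ (n : ℝ)]
        field_simp
      rw [hkey]
      calc (C * ‖y - z‖ / R) ^ n * M * ((n : ℝ) ^ n / n.factorial)
          ≤ (C * (2 * δ) / R) ^ n * M * (Real.exp 1) ^ n := by
            rw [← Real.exp_nat_mul, mul_one]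
            gcongr
        _ = (C * (2 * δ) * Real.exp 1 / R) ^ n * M := by
            rw [mul_right_comm, ← mul_pow]; ring
        _ ≤ (1 / 2) ^ n * M := by gcongr
    · have hk := (h.iterate_dirDeriv hU e k).contDiffOn
      have h1 : HasDerivAt (fun t : ℝ => z + t • e) e t := by
        simpa using ((hasDerivAt_id t).smul_const e).const_add z
      have hmem : z + t • e ∈ U :=
        hball (hballt t ht (Metric.mem_closedBall_self hR0.le))
      simp only [Function.iterate_succ_apply']
      exact (hk.differentiableAt_infty hU hmem).hasFDerivAt.comp_hasDerivAt t h1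
    · simpa using (iterate_dirDeriv_eventuallyEq_zero hfz e k).eq_of_nhds
    · refine IsHarmonicInOn.abs_iterate_dirDeriv_le hgrad hU (by positivity) n h ?_ ?_
      · rw [hnR]; exact (hballt t ht).trans hball
      · rw [hnR]; exact fun w hw => hM w (hballt t ht hw)
  have hlim : Filter.Tendsto (fun n : ℕ => (1 / 2 : ℝ) ^ n * M) Filter.atTop (𝓝 0) := by
    simpa using (tendsto_pow_atTop_nhds_zero_of_lt_one (by norm_num : (0 : ℝ) ≤ 1 / 2)
      (by norm_num)).mul_const M
  have := ge_of_tendsto hlim (Filter.eventually_gt_atTop 0 |>.mono hbound)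
  exact abs_eq_zero.1 (le_antisymm this (abs_nonneg _))

/-- **Unique continuation**: a harmonic function on a connected open set that vanishes near one
point vanishes identically. -/
theorem IsHarmonicInOn.eqOn_zero [Nonempty ι] {f : EuclideanSpace ℝ ι → ℝ}
    {U : Set (EuclideanSpace ℝ ι)} (hU : IsOpen U) (hUc : IsPreconnected U)
    (h : IsHarmonicInOn Finset.univ f U) {z : EuclideanSpace ℝ ι} (hz : z ∈ U)
    (hfz : f =ᶠ[𝓝 z] 0) : Set.EqOn f 0 U := by
  set Z : Set (EuclideanSpace ℝ ι) := {x | f =ᶠ[𝓝 x] 0} with hZ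
  have hZo : IsOpen Z := isOpen_setOfPred_eventually_nhds
  have hsub : U ⊆ Z := by
    refine hUc.subset_of_closure_inter_subset hZo ⟨z, hz, hfz⟩ fun x ⟨hxc, hxU⟩ => ?_
    obtain ⟨δ, hδ, hprop⟩ := h.exists_ball_eq_zero hU hxU
    obtain ⟨w, hwZ, hw⟩ := Metric.mem_closure_iff.1 hxc δ hδ
    exact Filter.eventually_of_mem (Metric.ball_mem_nhds x hδ)
      (hprop w (Metric.mem_ball'.2 hw) hwZ)
  exact fun x hx => (hsub hx).eq_of_nhds

end Harmonic

/-! ### Simultaneous solution of block Poisson equations by Fourier transform -/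

section Poisson

open scoped FourierTransform SchwartzMap LineDeriv

variable {ι : Type*} [Fintype ι]

/-- The inverse Fourier transform turns a derivative into a multiplication. -/
theorem fourierInv_dirDeriv {f : EuclideanSpace ℝ ι → ℝ} (hf : ContDiff ℝ ∞ f)
    (hc : HasCompactSupport f) (e ξ : EuclideanSpace ℝ ι) :
    𝓕⁻ (fun x => ((dirDeriv e f x : ℝ) : ℂ)) ξ =
      -(2 * Real.pi * Complex.I) * (inner ℝ ξ e : ℝ) * 𝓕⁻ (fun x => (f x : ℂ)) ξ := by
  have hc' : HasCompactSupport (fun x => (f x : ℂ)) := hc.comp_left Complex.ofReal_zero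
  have hf' : ContDiff ℝ ∞ (fun x => (f x : ℂ)) := Complex.ofRealCLM.contDiff.comp hf
  set G : 𝓢(EuclideanSpace ℝ ι, ℂ) := hc'.toSchwartzMap hf' with hG
  have hGf : (G : EuclideanSpace ℝ ι → ℂ) = fun x => (f x : ℂ) := rfl
  have hD : ((∂_{e} G : 𝓢(EuclideanSpace ℝ ι, ℂ)) : EuclideanSpace ℝ ι → ℂ) =
      fun x => ((dirDeriv e f x : ℝ) : ℂ) := by
    funext x
    rw [SchwartzMap.lineDerivOp_apply_eq_fderiv, hGf]
    have := (Complex.ofRealCLM.hasFDerivAt (x := f x)).comp x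
      (hf.differentiable (by simp) x).hasFDerivAt
    have h2 : fderiv ℝ (fun x => (f x : ℂ)) x = _ := this.fderiv
    rw [h2]
    simp [dirDeriv]
  have h1 := congrArg (fun H : 𝓢(EuclideanSpace ℝ ι, ℂ) => H ξ)
    (SchwartzMap.fourierInv_lineDerivOp_eq G e)
  have htg : (fun ξ : EuclideanSpace ℝ ι => inner ℝ ξ e).HasTemperateGrowth := by fun_prop
  simp only [smul_apply, SchwartzMap.smulLeftCLM_apply_apply htg,
    SchwartzMap.fourierInv_coe, hD, hGf] at h1
  rw [h1]
  simp [mul_assoc]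

theorem hasCompactSupport_dirDeriv {f : EuclideanSpace ℝ ι → ℝ} (hc : HasCompactSupport f)
    (e : EuclideanSpace ℝ ι) : HasCompactSupport (dirDeriv e f) :=
  hc.of_isClosed_subset (isClosed_tsupport _) (tsupport_dirDeriv_subset f e)

theorem contDiff_dirDeriv {f : EuclideanSpace ℝ ι → ℝ} (hf : ContDiff ℝ ∞ f)
    (e : EuclideanSpace ℝ ι) : ContDiff ℝ ∞ (dirDeriv e f) :=
  contDiffOn_univ.1 (hf.contDiffOn.dirDeriv_infty isOpen_univ e)

theorem inner_single_one {_ : DecidableEq ι} (i : ι) (ξ : EuclideanSpace ℝ ι) :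
    (inner ℝ ξ (EuclideanSpace.single i (1 : ℝ)) : ℝ) = ξ i := by
  simp [EuclideanSpace.inner_single_right]

/-- The inverse Fourier transform of a partial Laplacian. -/
theorem fourierInv_partialLaplacian {f : EuclideanSpace ℝ ι → ℝ} (hf : ContDiff ℝ ∞ f)
    (hc : HasCompactSupport f) (s : Finset ι) (ξ : EuclideanSpace ℝ ι) :
    𝓕⁻ (fun x => ((partialLaplacian s f x : ℝ) : ℂ)) ξ =
      ((-(2 * Real.pi) ^ 2 * ∑ i ∈ s, ξ i ^ 2 : ℝ) : ℂ) * 𝓕⁻ (fun x => (f x : ℂ)) ξ := by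
  have h1 : ∀ i, 𝓕⁻ (fun x => ((coordDeriv i (coordDeriv i f) x : ℝ) : ℂ)) ξ =
      ((-(2 * Real.pi) ^ 2 * ξ i ^ 2 : ℝ) : ℂ) * 𝓕⁻ (fun x => (f x : ℂ)) ξ := fun i => by
    rw [fourierInv_dirDeriv (contDiff_dirDeriv hf _) (hasCompactSupport_dirDeriv hc _),
      fourierInv_dirDeriv hf hc, inner_single_one]
    push_cast
    linear_combination (2 * Real.pi * ξ i) ^ 2 * 𝓕⁻ (fun x => (f x : ℂ)) ξ * Complex.I_sq
  simp only [Real.fourierInv_eq] at h1 ⊢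
  simp only [partialLaplacian, Complex.ofReal_sum, Finset.smul_sum]
  rw [integral_finsetSum]
  · rw [Finset.sum_congr rfl fun i _ => h1 i, ← Finset.sum_mul, Finset.mul_sum, Complex.ofReal_sum]
  · intro i _
    refine Continuous.integrable_of_hasCompactSupport ?_ ?_
    · have : Continuous (coordDeriv i (coordDeriv i f)) :=
        (contDiff_dirDeriv (contDiff_dirDeriv hf _) _).continuous
      simp only [Circle.smul_def]
      fun_prop
    · exact HasCompactSupport.smul_left ((hasCompactSupport_dirDeriv
        (hasCompactSupport_dirDeriv hc _) _).comp_left Complex.ofReal_zero)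

/-- The derivative of the real part of a Fourier transform. -/
theorem dirDeriv_re_fourier {w : EuclideanSpace ℝ ι → ℂ}
    (hw : Integrable w) (hw1 : Integrable fun ξ => ‖ξ‖ * ‖w ξ‖) (e : EuclideanSpace ℝ ι) :
    dirDeriv e (fun x => (𝓕 w x).re) =
      fun x => (𝓕 (fun ξ => -(2 * Real.pi * Complex.I) * (inner ℝ ξ e : ℝ) * w ξ) x).re := by
  funext x
  have h1 := Real.hasFDerivAt_fourier hw hw1 x
  have h2 := (Complex.reCLM.hasFDerivAt (x := 𝓕 w x)).comp x h1
  have h3 : fderiv ℝ (fun x => (𝓕 w x).re) x = _ := h2.fderiv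
  have hint : Integrable (VectorFourier.fourierSMulRight (innerSL ℝ) w) := by
    refine Integrable.mono' (hw1.const_mul (2 * Real.pi * ‖innerSL (E := EuclideanSpace ℝ ι) ℝ‖))
      hw.aestronglyMeasurable.fourierSMulRight (Filter.Eventually.of_forall fun ξ => ?_)
    rw [← mul_assoc]
    exact VectorFourier.norm_fourierSMulRight_le _ _ _
  have h4 : 𝓕 (VectorFourier.fourierSMulRight (innerSL ℝ) w) x e =
      𝓕 (fun ξ => VectorFourier.fourierSMulRight (innerSL ℝ) w ξ e) x :=
    Real.fourierIntegral_continuousLinearMap_apply' (L := innerSL ℝ) hint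
  simp only [dirDeriv, h3, ContinuousLinearMap.comp_apply, h4, Complex.reCLM_apply]
  refine congrArg (fun F : EuclideanSpace ℝ ι → ℂ => (𝓕 F x).re) (funext fun ξ => ?_)
  simp only [VectorFourier.fourierSMulRight_apply, smul_eq_mul, Complex.real_smul]
  change -(2 * Real.pi * Complex.I) * (((inner ℝ ξ e : ℝ) : ℂ) * w ξ) = _
  ring

/-- The partial Laplacian of the real part of a Fourier transform. -/
theorem partialLaplacian_re_fourier {w : EuclideanSpace ℝ ι → ℂ}
    (hw : ∀ k : ℕ, Integrable fun ξ => ‖ξ‖ ^ k * ‖w ξ‖) (hwm : AEStronglyMeasurable w)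
    (s : Finset ι) (x : EuclideanSpace ℝ ι) :
    partialLaplacian s (fun x => (𝓕 w x).re) x =
      (𝓕 (fun ξ => ((-(2 * Real.pi) ^ 2 * ∑ i ∈ s, ξ i ^ 2 : ℝ) : ℂ) * w ξ) x).re := by
  have hw0 : Integrable w := by
    refine (integrable_norm_iff hwm).1 ?_
    simpa using hw 0
  have hw1 : Integrable fun ξ => ‖ξ‖ * ‖w ξ‖ := by simpa using hw 1
  have hcoord : ∀ (i : ι) (ξ : EuclideanSpace ℝ ι), |ξ i| ≤ ‖ξ‖ := fun i ξ =>
    PiLp.norm_apply_le ξ i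
  have hmul : ∀ i, AEStronglyMeasurable (fun ξ : EuclideanSpace ℝ ι =>
      -(2 * Real.pi * Complex.I) * (ξ i : ℂ) * w ξ) := fun i =>
    (Continuous.aestronglyMeasurable (by fun_prop)).mul hwm
  have hnorm : ∀ (i : ι) (ξ : EuclideanSpace ℝ ι),
      ‖-(2 * Real.pi * Complex.I) * (ξ i : ℂ) * w ξ‖ ≤ 2 * Real.pi * (‖ξ‖ * ‖w ξ‖) := fun i ξ => by
    simp only [norm_mul, norm_neg, Complex.norm_real, Complex.norm_I, Real.norm_eq_abs,
      abs_of_pos Real.pi_pos, Complex.norm_ofNat, mul_one]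
    have := mul_le_mul_of_nonneg_right (hcoord i ξ) (norm_nonneg (w ξ))
    rw [mul_assoc]
    gcongr
  have hI0 : ∀ i, Integrable fun ξ : EuclideanSpace ℝ ι =>
      -(2 * Real.pi * Complex.I) * (ξ i : ℂ) * w ξ := fun i =>
    (hw1.const_mul _).mono' (hmul i) (Filter.Eventually.of_forall (hnorm i))
  have hI1 : ∀ i, Integrable fun ξ : EuclideanSpace ℝ ι =>
      ‖ξ‖ * ‖-(2 * Real.pi * Complex.I) * (ξ i : ℂ) * w ξ‖ := fun i => by
    refine ((hw 2).const_mul (2 * Real.pi)).mono'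
      (continuous_norm.aestronglyMeasurable.mul (hmul i).norm)
      (Filter.Eventually.of_forall fun ξ => ?_)
    rw [norm_mul, norm_norm, norm_norm]
    calc _ ≤ ‖ξ‖ * (2 * Real.pi * (‖ξ‖ * ‖w ξ‖)) := by gcongr; exact hnorm i ξ
      _ = _ := by ring
  have hI2 : ∀ i, Integrable fun ξ : EuclideanSpace ℝ ι =>
      ((-(2 * Real.pi) ^ 2 * ξ i ^ 2 : ℝ) : ℂ) * w ξ := fun i => by
    refine ((hw 2).const_mul ((2 * Real.pi) ^ 2)).mono'
      ((Continuous.aestronglyMeasurable (by fun_prop)).mul hwm)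
      (Filter.Eventually.of_forall fun ξ => ?_)
    rw [norm_mul, Complex.norm_real, Real.norm_eq_abs, abs_mul, abs_neg,
      abs_of_nonneg (sq_nonneg _), abs_of_nonneg (sq_nonneg (ξ i)), mul_assoc]
    have : ξ i ^ 2 ≤ ‖ξ‖ ^ 2 := sq_le_sq.2 ((hcoord i ξ).trans (le_abs_self _))
    gcongr
  have hsecond : ∀ i, coordDeriv i (coordDeriv i fun x => (𝓕 w x).re) x =
      (𝓕 (fun ξ => ((-(2 * Real.pi) ^ 2 * ξ i ^ 2 : ℝ) : ℂ) * w ξ) x).re := fun i => by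
    simp only [coordDeriv]
    rw [dirDeriv_re_fourier hw0 hw1]
    simp only [inner_single_one]
    rw [dirDeriv_re_fourier (hI0 i) (hI1 i)]
    simp only [inner_single_one]
    refine congrArg (fun F : EuclideanSpace ℝ ι → ℂ => (𝓕 F x).re) (funext fun ξ => ?_)
    push_cast
    linear_combination (2 * Real.pi * ξ i) ^ 2 * w ξ * Complex.I_sq
  simp only [partialLaplacian, hsecond]
  rw [← Complex.re_sum]
  congr 1
  simp only [Real.fourier_eq]
  rw [← integral_finsetSum]
  · refine integral_congr_ae (Filter.Eventually.of_forall fun ξ => ?_)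
    simp only
    rw [← Finset.smul_sum, ← Finset.sum_mul, Finset.mul_sum, Complex.ofReal_sum]
  · intro i _
    exact (Real.fourierIntegral_convergent_iff x).2 (hI2 i)

/-- All moments of a Schwartz function divided by `‖ξ‖ ^ 2` are finite in dimension at least
three. -/
theorem integrable_pow_mul_norm_inv_sq_mul (hdim : 3 ≤ Fintype.card ι)
    (S : 𝓢(EuclideanSpace ℝ ι, ℂ)) (c : ℝ) (k : ℕ) :
    Integrable fun ξ : EuclideanSpace ℝ ι => ‖ξ‖ ^ k * ‖((c * ‖ξ‖ ^ 2 : ℝ) : ℂ)⁻¹ * S ξ‖ := by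
  have hm : AEStronglyMeasurable (fun ξ : EuclideanSpace ℝ ι =>
      ‖ξ‖ ^ k * ‖((c * ‖ξ‖ ^ 2 : ℝ) : ℂ)⁻¹ * S ξ‖) := by
    refine Measurable.aestronglyMeasurable ?_
    have := S.continuous.measurable
    fun_prop
  have hnorm : ∀ ξ : EuclideanSpace ℝ ι, ‖((c * ‖ξ‖ ^ 2 : ℝ) : ℂ)⁻¹ * S ξ‖ =
      |c|⁻¹ * (‖ξ‖ ^ 2)⁻¹ * ‖S ξ‖ := fun ξ => by
    rw [norm_mul, norm_inv, Complex.norm_real, Real.norm_eq_abs, abs_mul, mul_inv,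
      abs_of_nonneg (sq_nonneg ‖ξ‖)]
  obtain ⟨C, hC⟩ : ∃ C, ∀ ξ, ‖S ξ‖ ≤ C := by
    obtain ⟨C, -, hC⟩ := S.decay 0 0
    exact ⟨C, fun ξ => by simpa using hC ξ⟩
  rw [← integrableOn_univ, ← Set.union_compl_self (Metric.ball (0 : EuclideanSpace ℝ ι) 1)]
  refine IntegrableOn.union ?_ ?_
  · refine integrableOn_ball_of_norm_le_rpow (α := 2) (C := |c|⁻¹ * C) ?_ ?_ ?_ hm
    · simp; omega
    · simp; exact_mod_cast hdim
    · refine (ae_restrict_iff' measurableSet_ball).2 (Filter.Eventually.of_forall fun ξ hξ => ?_)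
      have hξ1 : ‖ξ‖ ≤ 1 := by simpa using (Metric.mem_ball.1 hξ).le
      rw [hnorm, Real.norm_of_nonneg (by positivity), Real.rpow_neg (norm_nonneg _), Real.rpow_two]
      calc ‖ξ‖ ^ k * (|c|⁻¹ * (‖ξ‖ ^ 2)⁻¹ * ‖S ξ‖) ≤ 1 * (|c|⁻¹ * (‖ξ‖ ^ 2)⁻¹ * C) := by
            gcongr
            · exact pow_le_one₀ (norm_nonneg _) hξ1
            · exact hC ξ
        _ = |c|⁻¹ * C * (‖ξ‖ ^ 2)⁻¹ := by ring
  · refine Integrable.mono' ((S.integrable_pow_mul volume k).const_mul |c|⁻¹).integrableOn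
      hm.restrict ((ae_restrict_iff' measurableSet_ball.compl).2
        (Filter.Eventually.of_forall fun ξ hξ => ?_))
    have hξ1 : 1 ≤ ‖ξ‖ := by simpa using hξ
    rw [hnorm, Real.norm_of_nonneg (by positivity)]
    calc ‖ξ‖ ^ k * (|c|⁻¹ * (‖ξ‖ ^ 2)⁻¹ * ‖S ξ‖) ≤ ‖ξ‖ ^ k * (|c|⁻¹ * 1 * ‖S ξ‖) := by
          gcongr
          exact inv_le_one_of_one_le₀ (one_le_pow₀ hξ1)
      _ = |c|⁻¹ * (‖ξ‖ ^ k * ‖S ξ‖) := by ring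

/-- Compatible Poisson equations in complementary blocks of coordinates, with compactly supported
data, have a common smooth solution that tends to zero at infinity. On the Fourier side the
solution is the sum of the data divided by the symbol of the full Laplacian, and compatibility
makes it solve each block equation; it is integrable since the dimension is at least three, so the
Riemann–Lebesgue lemma gives the decay. -/
theorem exists_block_poisson_solution {κ σ : Type*} [Fintype κ] [Fintype σ]
    (hdim : 3 ≤ Fintype.card (κ × σ)) {g : κ → EuclideanSpace ℝ (κ × σ) → ℝ}
    (hg : ∀ j, ContDiff ℝ ∞ (g j)) (hc : ∀ j, HasCompactSupport (g j))
    (hcomp : ∀ i j x, partialLaplacian ({i} ×ˢ Finset.univ) (g j) x =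
      partialLaplacian ({j} ×ˢ Finset.univ) (g i) x) :
    ∃ u : EuclideanSpace ℝ (κ × σ) → ℝ, ContDiff ℝ ∞ u ∧
      Filter.Tendsto u (Filter.cocompact _) (𝓝 0) ∧
      ∀ j x, partialLaplacian ({j} ×ˢ Finset.univ) u x = g j x := by
  have hc' : ∀ j, HasCompactSupport (fun x => (g j x : ℂ)) := fun j =>
    (hc j).comp_left Complex.ofReal_zero
  have hg' : ∀ j, ContDiff ℝ ∞ (fun x => (g j x : ℂ)) := fun j =>
    Complex.ofRealCLM.contDiff.comp (hg j)
  set H : κ → 𝓢(EuclideanSpace ℝ (κ × σ), ℂ) := fun j => 𝓕⁻ ((hc' j).toSchwartzMap (hg' j))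
  have hH : ∀ j ξ, H j ξ = 𝓕⁻ (fun x => (g j x : ℂ)) ξ := fun j ξ => by
    simp only [H, SchwartzMap.fourierInv_coe]; rfl
  set S : 𝓢(EuclideanSpace ℝ (κ × σ), ℂ) := ∑ j, H j
  have hS : ∀ ξ, S ξ = ∑ j, H j ξ := fun ξ => by simp [S]
  set c : ℝ := -(2 * Real.pi) ^ 2 with hcdef
  have hc0 : c ≠ 0 := by
    have := Real.pi_pos
    simp only [hcdef, ne_eq, neg_eq_zero]
    positivity
  set w : EuclideanSpace ℝ (κ × σ) → ℂ := fun ξ => ((c * ‖ξ‖ ^ 2 : ℝ) : ℂ)⁻¹ * S ξ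
  have hw : ∀ k : ℕ, Integrable fun ξ => ‖ξ‖ ^ k * ‖w ξ‖ := fun k =>
    integrable_pow_mul_norm_inv_sq_mul hdim S c k
  have hwm : AEStronglyMeasurable w := by
    refine Measurable.aestronglyMeasurable ?_
    have := S.continuous.measurable
    fun_prop
  have hcompH : ∀ i j ξ, ((∑ s, ξ (i, s) ^ 2 : ℝ) : ℂ) * H j ξ =
      ((∑ s, ξ (j, s) ^ 2 : ℝ) : ℂ) * H i ξ := fun i j ξ => by
    have h1 := fourierInv_partialLaplacian (hg j) (hc j) ({i} ×ˢ Finset.univ) ξ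
    have h2 := fourierInv_partialLaplacian (hg i) (hc i) ({j} ×ˢ Finset.univ) ξ
    simp only [hcomp i j] at h1
    rw [h1, ← hH, ← hH] at h2
    simp only [Finset.sum_product, Finset.sum_singleton] at h2
    have hcc : (c : ℂ) ≠ 0 := by exact_mod_cast hc0
    apply mul_left_cancel₀ hcc
    rw [← mul_assoc, ← mul_assoc, ← Complex.ofReal_mul, ← Complex.ofReal_mul]
    exact h2
  refine ⟨fun x => (𝓕 w x).re, ?_, ?_, fun j x => ?_⟩
  · exact Complex.reCLM.contDiff.comp (Real.contDiff_fourier (N := ⊤) fun n _ => hw n)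
  · have h1 : Filter.Tendsto (𝓕 w) (Filter.cocompact _) (𝓝 0) :=
      tendsto_integral_exp_inner_smul_cocompact w
    rw [← Complex.zero_re]
    exact (Complex.continuous_re.tendsto 0).comp h1
  · rw [partialLaplacian_re_fourier hw hwm]
    have hae : (fun ξ : EuclideanSpace ℝ (κ × σ) =>
        ((-(2 * Real.pi) ^ 2 * ∑ i ∈ {j} ×ˢ Finset.univ, ξ i ^ 2 : ℝ) : ℂ) * w ξ) =ᵐ[volume]
        fun ξ => H j ξ := by
      have : Nonempty (κ × σ) := Fintype.card_pos_iff.1 (by omega)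
      have hne : ∀ᵐ ξ : EuclideanSpace ℝ (κ × σ), ξ ≠ 0 := by
        simp [ae_iff]
      filter_upwards [hne] with ξ hξ
      have hn : (‖ξ‖ ^ 2 : ℝ) = ∑ i, ∑ s, ξ (i, s) ^ 2 := by
        rw [EuclideanSpace.real_norm_sq_eq, Fintype.sum_prod_type]
      have h0 : ((‖ξ‖ ^ 2 : ℝ) : ℂ) ≠ 0 := by
        exact_mod_cast pow_ne_zero 2 (norm_ne_zero_iff.2 hξ)
      have hcc : (c : ℂ) ≠ 0 := by exact_mod_cast hc0
      have hsum : ((∑ s, ξ (j, s) ^ 2 : ℝ) : ℂ) * S ξ = ((‖ξ‖ ^ 2 : ℝ) : ℂ) * H j ξ := by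
        rw [hS, Finset.mul_sum, Finset.sum_congr rfl fun i _ => hcompH j i ξ, ← Finset.sum_mul, hn]
        push_cast
        rfl
      simp only [w, Finset.sum_product, Finset.sum_singleton]
      rw [← hcdef, Complex.ofReal_mul, Complex.ofReal_mul, mul_inv]
      field_simp
      linear_combination hsum
    have h2 : 𝓕 (fun ξ => H j ξ) x = (g j x : ℂ) := by
      have h3 : 𝓕 (H j) = (hc' j).toSchwartzMap (hg' j) := by
        simp only [H, FourierTransform.fourier_fourierInv_eq]
      have h4 := congrArg (fun G : 𝓢(EuclideanSpace ℝ (κ × σ), ℂ) => G x) h3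
      exact h4
    rw [Real.fourier_congr_ae hae, h2, Complex.ofReal_re]

end Poisson

/-! ### The Hartogs phenomenon for functions harmonic in each block of variables -/

section Hartogs

variable {κ σ : Type*} [Fintype κ] [Fintype σ]

/-- The embedding of the coordinate space of one block. -/
noncomputable def blockEmbedding (i : κ) :
    EuclideanSpace ℝ σ →L[ℝ] EuclideanSpace ℝ (κ × σ) :=
  open Classical in
  ∑ s, (EuclideanSpace.proj s : EuclideanSpace ℝ σ →L[ℝ] ℝ).smulRight
    (EuclideanSpace.single (i, s) (1 : ℝ))

theorem blockEmbedding_apply [DecidableEq κ] (i j : κ) (s : σ) (y : EuclideanSpace ℝ σ) :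
    blockEmbedding i y (j, s) = if j = i then y s else 0 := by
  classical
  by_cases h : j = i <;>
    simp [blockEmbedding, Finset.sum_apply, Pi.single_apply, h]

theorem blockEmbedding_single {_ : DecidableEq σ} {_ : DecidableEq (κ × σ)} (i : κ) (s : σ) :
    blockEmbedding i (EuclideanSpace.single s (1 : ℝ)) = EuclideanSpace.single (i, s) (1 : ℝ) := by
  classical
  ext ⟨j, t⟩
  rw [blockEmbedding_apply]
  by_cases h : j = i <;> simp [h]

theorem tendsto_add_blockEmbedding_cocompact (x : EuclideanSpace ℝ (κ × σ)) (i : κ) :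
    Filter.Tendsto (fun y => x + blockEmbedding i y) (Filter.cocompact (EuclideanSpace ℝ σ))
      (Filter.cocompact _) := by
  classical
  have hinj : Function.Injective (blockEmbedding (σ := σ) i) := fun y z hyz => by
    ext s
    have := congrArg (fun w : EuclideanSpace ℝ (κ × σ) => w (i, s)) hyz
    simpa [blockEmbedding_apply] using this
  have h1 : Topology.IsClosedEmbedding (blockEmbedding (σ := σ) i) :=
    LinearMap.isClosedEmbedding_of_injective (f := (blockEmbedding (σ := σ) i).toLinearMap)
      (LinearMap.ker_eq_bot.2 hinj)
  exact ((Homeomorph.addLeft x).isClosedEmbedding.comp h1).tendsto_cocompact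

/-- A function harmonic in one block of variables on a full affine slice, and tending to zero at
infinity, vanishes on this slice. -/
theorem eq_zero_of_block_harmonic_of_tendsto_zero [Nonempty σ]
    {u : EuclideanSpace ℝ (κ × σ) → ℝ} (hu : ContDiff ℝ ∞ u)
    (h0 : Filter.Tendsto u (Filter.cocompact _) (𝓝 0)) (i : κ) (x : EuclideanSpace ℝ (κ × σ))
    (hx : ∀ y, partialLaplacian ({i} ×ˢ Finset.univ) u (x + blockEmbedding i y) = 0) :
    u x = 0 := by
  have hd : ∀ (f : EuclideanSpace ℝ (κ × σ) → ℝ), ContDiff ℝ ∞ f → ∀ s,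
      coordDeriv s (fun y => f (x + blockEmbedding i y)) =
        fun y => coordDeriv (i, s) f (x + blockEmbedding i y) := fun f hf s => by
    funext y
    rw [coordDeriv, dirDeriv_comp_affine _ _ _ (hf.differentiable (by simp) _),
      blockEmbedding_single]
  have hv : IsHarmonicInOn Finset.univ (fun y => u (x + blockEmbedding i y)) Set.univ := by
    refine ⟨(hu.comp (contDiff_const.add (blockEmbedding i).contDiff)).contDiffOn, fun y _ => ?_⟩
    rw [← hx y]
    simp only [partialLaplacian, Finset.sum_product, Finset.sum_singleton, hd u hu]
    exact Finset.sum_congr rfl fun s _ => by rw [hd _ (contDiff_dirDeriv hu _)]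
  have := hv.eq_zero_of_tendsto_zero (h0.comp (tendsto_add_blockEmbedding_cocompact x i)) 0
  simpa using this

/-- If `S` is contained in an open set `Ω`, then each connected component of the complement of `S`
meets `Ω`: otherwise it would be open and closed. -/
theorem connectedComponentIn_compl_inter_nonempty {X : Type*} [TopologicalSpace X]
    [LocallyConnectedSpace X] [PreconnectedSpace X] {S Ω : Set X} (hS : IsClosed S)
    (hΩ : IsOpen Ω) (hΩne : Ω.Nonempty) (hSΩ : S ⊆ Ω) {p : X} (hp : p ∈ Sᶜ) :
    (connectedComponentIn Sᶜ p ∩ Ω).Nonempty := by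
  set W := connectedComponentIn Sᶜ p with hW
  by_contra hne
  rw [Set.not_nonempty_iff_eq_empty, ← Set.disjoint_iff_inter_eq_empty] at hne
  have hpW : p ∈ W := mem_connectedComponentIn hp
  have hcl : closure W ⊆ Sᶜ := fun x hx hxS =>
    Set.disjoint_left.1 (hne.closure_left hΩ) hx (hSΩ hxS)
  have hclW : closure W ⊆ W :=
    isPreconnected_connectedComponentIn.closure.subset_connectedComponentIn
      (subset_closure hpW) hcl
  have hclopen : IsClopen W :=
    ⟨closure_subset_iff_isClosed.1 hclW, hS.isOpen_compl.connectedComponentIn⟩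
  rcases isClopen_iff.1 hclopen with h | h
  · exact (h ▸ hpW : p ∈ (∅ : Set X))
  · obtain ⟨q, hq⟩ := hΩne
    exact Set.disjoint_left.1 hne (h ▸ Set.mem_univ q) hq

/-- **Hartogs' theorem** for functions that are harmonic in each of at least two blocks of
variables. -/
theorem exists_block_harmonic_extension [Nontrivial κ] [Nontrivial σ]
    {Ω K : Set (EuclideanSpace ℝ (κ × σ))} (hΩ : IsOpen Ω) (hΩne : Ω.Nonempty) (hK : IsCompact K)
    (hKΩ : K ⊆ Ω) (hΩK : IsPreconnected (Ω \ K)) {f : EuclideanSpace ℝ (κ × σ) → ℝ}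
    (hf : ∀ j, IsHarmonicInOn ({j} ×ˢ Finset.univ) f (Ω \ K)) :
    ∃ F : EuclideanSpace ℝ (κ × σ) → ℝ,
      (∀ j, IsHarmonicInOn ({j} ×ˢ Finset.univ) F Ω) ∧ Set.EqOn F f (Ω \ K) := by
  classical
  obtain ⟨i₀, i₁, hi⟩ := exists_pair_ne κ
  obtain ⟨s₀⟩ : Nonempty σ := inferInstance
  have hΩKo : IsOpen (Ω \ K) := hΩ.sdiff hK.isClosed
  have hdim : 3 ≤ Fintype.card (κ × σ) := by
    rw [Fintype.card_prod]
    have h1 := Fintype.one_lt_card (α := κ)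
    have h2 := Fintype.one_lt_card (α := σ)
    nlinarith
  -- cutting off `f` near `K` leaves compactly supported partial Laplacians
  obtain ⟨η, hη, hηc, hηΩ, V, hV, hKV, hηV⟩ := exists_smooth_cutoff hK hΩ hKΩ
  obtain ⟨θ, hθ, hθc, hθΩ, V', hV', hSV', hθV'⟩ := exists_smooth_cutoff hηc hΩ hηΩ
  have hKη : K ⊆ tsupport η := fun x hx =>
    subset_tsupport η (by simp [Function.mem_support, hηV x (hKV hx)])
  have hSo : IsOpen (tsupport η)ᶜ := (isClosed_tsupport η).isOpen_compl
  set f' : EuclideanSpace ℝ (κ × σ) → ℝ := fun x => (1 - η x) * f x with hf'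
  have hf'eq : Set.EqOn f' f (tsupport η)ᶜ := fun x hx => by
    simp [hf', image_eq_zero_of_notMem_tsupport hx]
  have hf'd : ContDiffOn ℝ ∞ f' Ω := fun x hx => by
    refine ContDiffAt.contDiffWithinAt ?_
    by_cases hxK : x ∈ K
    · have : f' =ᶠ[𝓝 x] fun _ => 0 := by
        filter_upwards [hV.mem_nhds (hKV hxK)] with y hy
        simp [hf', hηV y hy]
      exact contDiffAt_const.congr_of_eventuallyEq this
    · exact (contDiffAt_const.sub hη.contDiffAt).mul
        ((hf i₀).contDiffOn.contDiffAt (hΩKo.mem_nhds ⟨hx, hxK⟩))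
  have hLf' : ∀ j, ∀ x ∈ Ω, x ∉ tsupport η →
      partialLaplacian ({j} ×ˢ Finset.univ) f' x = 0 := fun j x hx hxS => by
    rw [partialLaplacian_eqOn hSo hf'eq _ hxS]
    exact (hf j).partialLaplacian_eq_zero x ⟨hx, fun hxK => hxS (hKη hxK)⟩
  -- the factor `θ` only serves to extend the partial Laplacians by zero
  set g : κ → EuclideanSpace ℝ (κ × σ) → ℝ := fun j x =>
    partialLaplacian ({j} ×ˢ Finset.univ) f' x * θ x with hg
  have hgΩ : ∀ j, Set.EqOn (g j) (partialLaplacian ({j} ×ˢ Finset.univ) f') Ω := fun j x hx => by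
    by_cases hxS : x ∈ tsupport η
    · simp [hg, hθV' x (hSV' hxS)]
    · simp only [hg, hLf' j x hx hxS, zero_mul]
  have hgS : ∀ j, Set.EqOn (g j) (fun _ => 0) (tsupport η)ᶜ := fun j x hxS => by
    by_cases hx : x ∈ Ω
    · simp only [hg, hLf' j x hx hxS, zero_mul]
    · simp [hg, image_eq_zero_of_notMem_tsupport fun h => hx (hθΩ h)]
  have hgd : ∀ j, ContDiff ℝ ∞ (g j) := fun j =>
    contDiff_mul_of_tsupport_subset hΩ (contDiffOn_partialLaplacian hΩ hf'd _) hθ hθΩ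
  obtain ⟨u, hu, hu0, hug⟩ := exists_block_poisson_solution hdim hgd
    (fun j => HasCompactSupport.mul_left hθc) fun i j x => by
      by_cases hx : x ∈ Ω
      · rw [partialLaplacian_eqOn hΩ (hgΩ j) _ hx, partialLaplacian_eqOn hΩ (hgΩ i) _ hx,
          partialLaplacian_comm hΩ hf'd _ _ hx]
      · have hxS : x ∈ (tsupport η)ᶜ := fun h => hx (hηΩ h)
        rw [partialLaplacian_eqOn hSo (hgS j) _ hxS, partialLaplacian_eqOn hSo (hgS i) _ hxS,
          partialLaplacian_zero, partialLaplacian_zero]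
  have huS : ∀ j, IsHarmonicInOn ({j} ×ˢ Finset.univ) u (tsupport η)ᶜ := fun j =>
    ⟨hu.contDiffOn, fun x hx => by rw [hug j x, hgS j hx]⟩
  have hF : ∀ j, IsHarmonicInOn ({j} ×ˢ Finset.univ) (fun x => f' x - u x) Ω := fun j =>
    ⟨hf'd.sub hu.contDiffOn, fun x hx => by
      rw [partialLaplacian_sub hΩ hf'd hu.contDiffOn _ hx, hug j x, hgΩ j hx, sub_self]⟩
  refine ⟨fun x => f' x - u x, hF, ?_⟩
  -- `u` vanishes wherever a coordinate in the block `i₁` is large, since the slice through such a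
  -- point in the directions of the block `i₀` avoids the support of `η`
  obtain ⟨R, hR⟩ := hηc.isBounded.exists_norm_le
  have hfar : ∀ x : EuclideanSpace ℝ (κ × σ), R < |x (i₁, s₀)| → x ∈ (tsupport η)ᶜ :=
    fun x hx hxS => by
      have h1 := hR x hxS
      have h2 : |x (i₁, s₀)| ≤ ‖x‖ := PiLp.norm_apply_le x (i₁, s₀)
      linarith
  have hu_far : ∀ x : EuclideanSpace ℝ (κ × σ), R < |x (i₁, s₀)| → u x = 0 := fun x hx => by
    refine eq_zero_of_block_harmonic_of_tendsto_zero hu hu0 i₀ x fun y => ?_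
    refine (huS i₀).partialLaplacian_eq_zero _ (hfar _ ?_)
    simpa [blockEmbedding_apply, hi.symm] using hx
  set p : EuclideanSpace ℝ (κ × σ) := EuclideanSpace.single (i₁, s₀) (|R| + 1) with hp
  have hpR : R < |p (i₁, s₀)| := by
    have h1 : p (i₁, s₀) = |R| + 1 := by simp [hp]
    rw [h1, abs_of_pos (by positivity)]
    linarith [le_abs_self R]
  have hup : u =ᶠ[𝓝 p] 0 := by
    have hopen : IsOpen {x : EuclideanSpace ℝ (κ × σ) | R < |x (i₁, s₀)|} :=
      isOpen_lt continuous_const (by fun_prop)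
    filter_upwards [hopen.mem_nhds hpR] with x hx using hu_far x hx
  have hWo : IsOpen (connectedComponentIn (tsupport η)ᶜ p) := hSo.connectedComponentIn
  have huW : Set.EqOn u 0 (connectedComponentIn (tsupport η)ᶜ p) :=
    (IsHarmonicInOn.of_blocks fun j =>
      (huS j).mono (connectedComponentIn_subset _ _)).eqOn_zero hWo
      isPreconnected_connectedComponentIn (mem_connectedComponentIn (hfar p hpR)) hup
  obtain ⟨q, hqW, hqΩ⟩ := connectedComponentIn_compl_inter_nonempty (isClosed_tsupport η) hΩ hΩne
    hηΩ (hfar p hpR)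
  have hsub : ∀ x ∈ connectedComponentIn (tsupport η)ᶜ p, x ∉ K := fun x hx hxK =>
    connectedComponentIn_subset _ _ hx (hKη hxK)
  have hdiff : IsHarmonicInOn Finset.univ (fun x => f' x - u x - f x) (Ω \ K) :=
    IsHarmonicInOn.of_blocks fun j => ((hF j).mono Set.sdiff_subset).sub hΩKo (hf j)
  have hzero := hdiff.eqOn_zero hΩKo hΩK ⟨hqΩ, hsub q hqW⟩ (by
    filter_upwards [hWo.mem_nhds hqW] with x hx
    simp [hf'eq (connectedComponentIn_subset _ _ hx), huW hx])
  exact fun x hx => sub_eq_zero.1 (hzero hx)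

end Hartogs

/-! ### Monogenic functions have harmonic components -/

section Clifford

/-- Two families of endomorphisms `T`, `T'` satisfying the polarized Clifford relations
`T' s ∘ T t + T' t ∘ T s = 2 δ_{st}`: the first order operators with coefficients `T` and `T'`
compose to the Laplacian. -/
def IsCliffordPair {σ V : Type*} [DecidableEq σ] [AddCommGroup V] [Module ℝ V]
    (T T' : σ → V →ₗ[ℝ] V) : Prop :=
  ∀ s t a, T' s (T t a) + T' t (T s a) = if s = t then (2 : ℝ) • a else 0

/-- A family of anticommuting complex structures, together with the identity, satisfies the
polarized Clifford relations with its conjugate family. -/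
theorem isCliffordPair_of_anticomm {m : ℕ} {V : Type*} [AddCommGroup V] [Module ℝ V]
    {T : Fin (m + 1) → V →ₗ[ℝ] V} (h0 : ∀ a, T 0 a = a) (hsq : ∀ s ≠ 0, ∀ a, T s (T s a) = -a)
    (hanti : ∀ s t, s ≠ 0 → t ≠ 0 → s ≠ t → ∀ a, T s (T t a) + T t (T s a) = 0) :
    IsCliffordPair T (fun s => if s = 0 then T s else -T s) := by
  intro s t a
  rcases eq_or_ne s t with rfl | hst
  · by_cases hs : s = 0
    · subst hs; simp [h0, two_smul]
    · simp [hs, hsq s hs, two_smul]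
  · by_cases hs : s = 0
    · subst hs; simp [hst.symm, h0, hst]
    · by_cases ht : t = 0
      · subst ht; simp [hs, h0]
      · have := hanti s t hs ht hst a
        simp only [hs, ht, hst, if_false, LinearMap.neg_apply]
        rw [← neg_add, this, neg_zero]

variable {σ V : Type*} [Fintype σ] [DecidableEq σ] [AddCommGroup V] [Module ℝ V]

theorem IsCliffordPair.sum_diag_eq_zero {T T' : σ → V →ₗ[ℝ] V} (h : IsCliffordPair T T')
    {P : σ → σ → V} (hP : ∀ s t, P s t = P t s) (hT : ∀ s, ∑ t, T t (P s t) = 0) :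
    ∑ s, P s s = 0 := by
  have h1 : ∑ s, ∑ t, T' s (T t (P s t)) = 0 := by
    refine Finset.sum_eq_zero fun s _ => ?_
    rw [← map_sum, hT s, map_zero]
  have h2 : ∑ s, ∑ t, T' t (T s (P s t)) = 0 := by
    rw [Finset.sum_comm, ← h1]
    exact Finset.sum_congr rfl fun s _ => Finset.sum_congr rfl fun t _ => by rw [hP s t]
  have h3 : (2 : ℝ) • ∑ s, P s s = 0 := by
    rw [← add_zero (0 : V), ← h1]
    nth_rewrite 2 [h1]
    rw [← h2, ← Finset.sum_add_distrib, Finset.smul_sum]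
    refine Finset.sum_congr rfl fun s _ => ?_
    rw [← Finset.sum_add_distrib, Finset.sum_congr rfl fun t _ => h s t (P s t)]
    simp
  exact (smul_eq_zero.1 h3).resolve_left two_ne_zero

/-- The coordinate form of `IsCliffordPair.sum_diag_eq_zero`. -/
theorem IsCliffordPair.sum_diag_coord_eq_zero {d : ℕ} (b : Module.Basis (Fin d) ℝ V)
    {T T' : σ → V →ₗ[ℝ] V} (h : IsCliffordPair T T') {D : σ → σ → Fin d → ℝ}
    (hD : ∀ s t k, D s t k = D t s k)
    (hT : ∀ s l, ∑ p : σ × Fin d, b.repr (T p.1 (b p.2)) l * D s p.1 p.2 = 0) (k : Fin d) :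
    ∑ s, D s s k = 0 := by
  have := h.sum_diag_eq_zero (P := fun s t => ∑ k, D s t k • b k)
    (fun s t => by simp only [hD s t]) (fun s => by
      refine b.ext_elem fun l => ?_
      rw [map_zero, Finsupp.zero_apply, ← hT s l, Fintype.sum_prod_type]
      simp [map_sum, Finsupp.finsetSum_apply, mul_comm])
  have h2 := congrArg (fun a => b.repr a k) this
  simpa [map_sum, Finsupp.finsetSum_apply, Finsupp.single_apply] using h2

end Clifford

section Monogenic

variable {A : Type*} [NonAssocRing A] [Module ℝ A] {n m d : ℕ}

theorem coordDeriv_eq {ι : Type*} [Fintype ι] {_ : DecidableEq ι} (i : ι)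
    (f : EuclideanSpace ℝ ι → ℝ) (x : EuclideanSpace ℝ ι) :
    coordDeriv i f x = fderiv ℝ f x (EuclideanSpace.single i (1 : ℝ)) := by
  simp only [coordDeriv, dirDeriv]
  congr!

/-- The components of a first order differential expression. -/
theorem repr_sum_partialDeriv (b : Module.Basis (Fin d) ℝ A) (T : Fin (m + 1) → A →ₗ[ℝ] A)
    (f : HypercomplexSpace n m → A) (j : Fin n) (x : HypercomplexSpace n m) (l : Fin d) :
    b.repr (∑ s, T s (partialDeriv b f j s x)) l =
      ∑ p : Fin (m + 1) × Fin d, b.repr (T p.1 (b p.2)) l *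
        coordDeriv (j, p.1) (fun y => b.repr (f y) p.2) x := by
  rw [Fintype.sum_prod_type]
  simp [partialDeriv, map_sum, Finsupp.finsetSum_apply, coordDeriv_eq, mul_comm]

/-- Second partial derivatives commute when tested against a function that is merely `C¹`. -/
theorem integral_coordDeriv_mul_coordDeriv_comm {ι : Type*} [Fintype ι]
    {f ψ : EuclideanSpace ℝ ι → ℝ} {U : Set (EuclideanSpace ℝ ι)} (hU : IsOpen U)
    (hf : ContDiffOn ℝ 1 f U) (hψ : ContDiff ℝ ∞ ψ) (hc : HasCompactSupport ψ)
    (hψU : tsupport ψ ⊆ U) (i k : ι) :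
    ∫ x, coordDeriv k f x * coordDeriv i ψ x = ∫ x, coordDeriv i f x * coordDeriv k ψ x := by
  have h : ∀ a c : ι, ∫ x, coordDeriv a f x * coordDeriv c ψ x =
      -∫ x, f x * coordDeriv a (coordDeriv c ψ) x := fun a c =>
    integral_dirDeriv_mul_eq_neg volume hU hf
      ((contDiff_dirDeriv hψ _).of_le (by exact_mod_cast le_top))
      (hasCompactSupport_dirDeriv hc _) ((tsupport_dirDeriv_subset ψ _).trans hψU) _
  rw [h, h]
  exact congrArg _ (integral_congr_ae (Filter.Eventually.of_forall fun x => congrArg _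
    (dirDeriv_comm isOpen_univ hψ.contDiffOn _ _ (Set.mem_univ x))))

/-- A solution of class `C¹` of the first order system given by a Clifford pair has smooth
components, and these are harmonic in each block of variables. -/
theorem isHarmonicInOn_repr_of_clifford {b : Module.Basis (Fin d) ℝ A}
    {T T' : Fin (m + 1) → A →ₗ[ℝ] A} (hT : IsCliffordPair T T') {f : HypercomplexSpace n m → A}
    {U : Set (HypercomplexSpace n m)} (hU : IsOpen U) (hf : IsC1On b f U)
    (hmon : ∀ x ∈ U, ∀ j : Fin n, ∑ s, T s (partialDeriv b f j s x) = 0) (k : Fin d)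
    (j : Fin n) : IsHarmonicInOn ({j} ×ˢ Finset.univ) (fun x => b.repr (f x) k) U := by
  have : Nonempty (Fin n) := ⟨j⟩
  have heq : ∀ (j : Fin n) (l : Fin d), ∀ x ∈ U, ∑ p : Fin (m + 1) × Fin d,
      b.repr (T p.1 (b p.2)) l * coordDeriv (j, p.1) (fun y => b.repr (f y) p.2) x = 0 :=
    fun j l x hx => by
      rw [← repr_sum_partialDeriv, hmon x hx j, map_zero, Finsupp.zero_apply]
  have hsmooth : ∀ k, ContDiffOn ℝ ∞ (fun x => b.repr (f x) k) U := fun k => by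
    refine IsWeaklyHarmonicOn.contDiffOn hU (hf k) fun ψ hψ hc hψU => ?_
    have hint : ∀ (i i' : Fin n × Fin (m + 1)) (k : Fin d), Integrable fun x =>
        coordDeriv i' (fun y => b.repr (f y) k) x * coordDeriv i ψ x := fun i i' k =>
      (continuous_mul_of_tsupport_subset hU ((hf k).continuousOn_dirDeriv hU _)
        (contDiff_dirDeriv hψ _).continuous
        ((tsupport_dirDeriv_subset ψ _).trans hψU)).integrable_of_hasCompactSupport
        (HasCompactSupport.mul_left (hasCompactSupport_dirDeriv hc _))
    rw [integral_finsetSum _ fun i _ => hint i i k, Fintype.sum_prod_type]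
    refine Finset.sum_eq_zero fun j _ => ?_
    refine hT.sum_diag_coord_eq_zero b (D := fun s t k =>
      ∫ x, coordDeriv (j, t) (fun y => b.repr (f y) k) x * coordDeriv (j, s) ψ x)
      (fun s t k => integral_coordDeriv_mul_coordDeriv_comm hU (hf k) hψ hc hψU _ _)
      (fun s l => ?_) k
    simp only [← integral_const_mul]
    rw [← integral_finsetSum _ fun p _ => (hint _ _ _).const_mul _]
    refine integral_eq_zero_of_ae (Filter.Eventually.of_forall fun x => ?_)
    simp only [Pi.zero_apply, ← mul_assoc]
    rw [← Finset.sum_mul]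
    by_cases hx : x ∈ U
    · rw [heq j l x hx, zero_mul]
    · rw [image_eq_zero_of_notMem_tsupport (f := coordDeriv (j, s) ψ)
        fun h => hx (hψU (tsupport_dirDeriv_subset ψ _ h)), mul_zero]
  refine ⟨hsmooth k, fun x hx => ?_⟩
  rw [partialLaplacian, Finset.sum_product, Finset.sum_singleton]
  refine hT.sum_diag_coord_eq_zero b (D := fun s t k =>
    coordDeriv (j, s) (coordDeriv (j, t) fun y => b.repr (f y) k) x)
    (fun s t k => dirDeriv_comm hU (hsmooth k) _ _ hx) (fun s l => ?_) k
  have hd : ∀ p : Fin (m + 1) × Fin d, DifferentiableAt ℝ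
      (coordDeriv (j, p.1) fun y => b.repr (f y) p.2) x := fun p =>
    ((hsmooth p.2).dirDeriv_infty hU _).differentiableAt_infty hU hx
  have h1 : ∀ e, ∑ p : Fin (m + 1) × Fin d, b.repr (T p.1 (b p.2)) l *
      dirDeriv e (coordDeriv (j, p.1) fun y => b.repr (f y) p.2) x = 0 := fun e => by
    have h2 := dirDeriv_eqOn hU (g := fun _ => 0) (heq j l) e hx
    rw [dirDeriv_sum _ fun p _ => (hd p).const_mul _] at h2
    simp only [dirDeriv_const_mul (hd _)] at h2
    rw [h2]
    simp [dirDeriv]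
  exact h1 _

/-- **Hartogs' theorem** for the first order system given by a Clifford pair. -/
theorem exists_extension_of_clifford {b : Module.Basis (Fin d) ℝ A}
    {T T' : Fin (m + 1) → A →ₗ[ℝ] A} (hT : IsCliffordPair T T') (hm : 1 ≤ m) (hn : 1 < n)
    {Ω K : Set (HypercomplexSpace n m)} (hΩ : IsOpen Ω) (hΩc : IsConnected Ω) (hK : IsCompact K)
    (hKΩ : K ⊆ Ω) (hΩK : IsConnected (Ω \ K)) {f : HypercomplexSpace n m → A}
    (hf : IsC1On b f (Ω \ K))
    (hmon : ∀ x ∈ Ω \ K, ∀ j : Fin n, ∑ s, T s (partialDeriv b f j s x) = 0) :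
    ∃ F : HypercomplexSpace n m → A, (IsC1On b F Ω ∧
      ∀ x ∈ Ω, ∀ j : Fin n, ∑ s, T s (partialDeriv b F j s x) = 0) ∧ Set.EqOn F f (Ω \ K) := by
  have : Nontrivial (Fin n) := Fin.nontrivial_iff_two_le.2 hn
  have : Nontrivial (Fin (m + 1)) := Fin.nontrivial_iff_two_le.2 (by omega)
  have hΩKo : IsOpen (Ω \ K) := hΩ.sdiff hK.isClosed
  choose G hG hGf using fun k => exists_block_harmonic_extension hΩ hΩc.nonempty hK hKΩ
    hΩK.isPreconnected (isHarmonicInOn_repr_of_clifford hT hΩKo hf hmon k)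
  have hrepr : ∀ k x, b.repr (∑ l, G l x • b l) k = G k x := fun k x => by
    simp [map_sum, Finsupp.finsetSum_apply, Finsupp.single_apply]
  have hEq : Set.EqOn (fun x => ∑ l, G l x • b l) f (Ω \ K) := fun x hx => b.ext_elem fun k => by
    rw [hrepr, hGf k hx]
  refine ⟨fun x => ∑ l, G l x • b l, ⟨fun k => ?_, fun x hx j => ?_⟩, hEq⟩
  · simp only [hrepr]
    exact (hG k (Classical.arbitrary _)).contDiffOn.of_le (by exact_mod_cast le_top)
  -- the components of the equation are harmonic on `Ω` and vanish on `Ω \ K`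
  · refine b.ext_elem fun l => ?_
    rw [map_zero, Finsupp.zero_apply, repr_sum_partialDeriv]
    simp only [hrepr]
    have hh : IsHarmonicInOn Finset.univ (fun x => ∑ p : Fin (m + 1) × Fin d,
        b.repr (T p.1 (b p.2)) l * coordDeriv (j, p.1) (G p.2) x) Ω :=
      IsHarmonicInOn.of_blocks fun i => IsHarmonicInOn.sum_const_mul _ _ hΩ fun p =>
        (hG p.2 i).dirDeriv_of_isOpen hΩ _
    obtain ⟨q, hq⟩ := hΩK.nonempty
    refine hh.eqOn_zero hΩ hΩc.isPreconnected hq.1 ?_ hx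
    filter_upwards [hΩKo.mem_nhds hq] with y hy
    have h1 : ∀ p : Fin (m + 1) × Fin d, coordDeriv (j, p.1) (G p.2) y =
        coordDeriv (j, p.1) (fun y => b.repr (f y) p.2) y := fun p =>
      dirDeriv_eqOn hΩKo (hGf p.2) _ hy
    simp only [h1, Pi.zero_apply]
    rw [← repr_sum_partialDeriv, hmon y hy j, map_zero, Finsupp.zero_apply]

end Monogenic

/-! ### Multiplication operators in an alternative algebra -/

section Algebra

variable {A : Type*} [NonAssocRing A]

theorem IsAlternative.mul_mul_add_mul_mul (hA : IsAlternative A) (a c x : A) :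
    a * (c * x) + c * (a * x) = (a * c + c * a) * x := by
  have h := hA.left_alt (a + c) x
  simp only [add_mul, mul_add, hA.left_alt] at h
  simp only [add_mul]
  rw [← sub_eq_zero] at h ⊢
  rw [← neg_eq_zero, ← h]
  abel

theorem IsAlternative.mul_mul_add_mul_mul_right (hA : IsAlternative A) (a c x : A) :
    (x * c) * a + (x * a) * c = x * (a * c + c * a) := by
  have h := hA.right_alt (a + c) x
  simp only [add_mul, mul_add, hA.right_alt] at h
  simp only [mul_add]
  rw [← sub_eq_zero] at h ⊢
  rw [← h]
  abel

theorem mul_self_of_mem_imaginaryUnits [StarRing A] {a : A} (ha : a ∈ imaginaryUnits A) :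
    a * a = -1 := by
  have h1 : star a = -a := (eq_neg_of_add_eq_zero_right ha.1)
  have h2 := ha.2
  rw [h1, mul_neg] at h2
  rw [← h2, neg_neg]

end Algebra

theorem mainTheorem6 {A : Type*} [NonAssocRing A] [Module ℝ A] [SMulCommClass ℝ A A]
    [IsScalarTower ℝ A A] [StarRing A] [StarModule ℝ A] (hA : IsAlternative A)
    (M : Submodule ℝ A) (hM : IsHypercomplexSubspace M)
    {m : ℕ} (v : Fin (m + 1) → A) (hv : IsHypercomplexBasis M v)
    {d : ℕ} (b : Module.Basis (Fin d) ℝ A) (hmd : m + 1 ≤ d)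
    (hb : ∀ s, b (Fin.castLE hmd s) = v s)
    {n : ℕ} (hn : 1 < n) (Ω : Set (HypercomplexSpace n m)) (hΩo : IsOpen Ω) (hΩc : IsConnected Ω)
    (K : Set (HypercomplexSpace n m)) (hK : IsCompact K) (hKΩ : K ⊆ Ω)
    (hΩK : IsConnected (Ω \ K)) :
    (∀ f : HypercomplexSpace n m → A, IsLeftMonogenicOn b v f (Ω \ K) →
      ∃ F : HypercomplexSpace n m → A, IsLeftMonogenicOn b v F Ω ∧ Set.EqOn F f (Ω \ K)) ∧
    (∀ f : HypercomplexSpace n m → A, IsRightMonogenicOn b v f (Ω \ K) →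
      ∃ F : HypercomplexSpace n m → A, IsRightMonogenicOn b v F Ω ∧ Set.EqOn F f (Ω \ K)) := by
  have hsq : ∀ s, s ≠ 0 → v s * v s = -1 := fun s hs =>
    mul_self_of_mem_imaginaryUnits (hv.mem_units s hs)
  have hanti : ∀ s t, s ≠ 0 → t ≠ 0 → s ≠ t → v s * v t + v t * v s = 0 := fun s t hs ht hst => by
    rw [hv.anticomm s t hs ht hst, neg_add_cancel]
  have hleft := isCliffordPair_of_anticomm (T := fun s => LinearMap.mulLeft ℝ (v s))
    (fun a => by simp [hv.zero_eq])
    (fun s hs a => by simp [← hA.left_alt, hsq s hs])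
    (fun s t hs ht hst a => by
      simp only [LinearMap.mulLeft_apply]
      rw [hA.mul_mul_add_mul_mul, hanti s t hs ht hst, zero_mul])
  have hright := isCliffordPair_of_anticomm (T := fun s => LinearMap.mulRight ℝ (v s))
    (fun a => by simp [hv.zero_eq])
    (fun s hs a => by simp [hA.right_alt, hsq s hs])
    (fun s t hs ht hst a => by
      simp only [LinearMap.mulRight_apply]
      rw [hA.mul_mul_add_mul_mul_right, hanti s t hs ht hst, mul_zero])
  exact ⟨fun f hf => exists_extension_of_clifford hleft hv.one_le hn hΩo hΩc hK hKΩ hΩK hf.1 hf.2,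
    fun f hf => exists_extension_of_clifford hright hv.one_le hn hΩo hΩc hK hKΩ hΩK hf.1 hf.2⟩
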